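/- Call a real sequence $(m_n)_{n\ge 1}$ a *moment sequence* if there is a random variable $X>0$ with $\mathbb{E}[X^n]=m_n<\infty$ for all integers $n\ge 1$. It is *infinitely divisible* if $(m_n^t)_{n\ge 1}$ is a moment sequence for every real $t>0$. A moment sequence is *moment-determinate* if there is only one probability law on $[0,\infty)$ whose moments are the $m_n$, $n\ge 1$ (determinacy in the sense of Stieltjes). For $a,b,s>0$ and real $x\ge 0$ put $$\mu_x=\mu_x(a,b,s)=\frac{\Gamma(a+sx)\,\Gamma(a+b)}{\Gamma(a)\,\Gamma(a+b+sx)}.$$ 1. For all $a,b,s>0$, the sequence $(\mu_n)_{n\ge 1}$ is an infinitely divisible moment sequence, and for every real $t>0$ the sequences $(\mu_n^t)_{n\ge 1}$ and $(\mu_{nt})_{n\ge 1}$ are moment-determinate moment sequences. 2. Let $C_n=\frac{1}{n+1}\binom{2n}{n}$ be the Catalan numbers. Then $\mu_n(\tfrac12,\tfrac32,1)=4^{-n}C_n$ for all $n\ge 0$. The sequence $(C_n)_{n\ge 1}$ is an infinitely divisible moment sequence, $(C_n^t)_{n\ge 1}$ is moment-determinate for every real $t>0$, and $(C_{kn})_{n\ge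 1}$ is moment-determinate for every integer $k\ge 1$. 3. For all $a,s>0$ and every integer $n\ge 0$, $\lim_{b\to\infty} b^{sn}\mu_n(a,b,s)=\Gamma(a+sn)/\Gamma(a)$. The sequence $\left(\Gamma(a+sn)/\Gamma(a)\right)_{n\ge 1}$ is an infinitely divisible moment sequence, and for every real $t>0$ the moment sequence $\left(\left(\Gamma(a+sn)/\Gamma(a)\right)^t\right)_{n\ge 1}$ is moment-determinate if and only if $st\le 2$. -/

import Mathlib

open MeasureTheory Filter Topology

namespace StieltjesMoment

/-- `ν` is the law of a random variable with values in `[0, ∞)`, all of whose moments of order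
`n ≥ 1` are finite, the `n`-th one being `m n`. -/
structure IsMomentLaw (m : ℕ → ℝ) (ν : Measure ℝ) : Prop where
  isProbabilityMeasure : IsProbabilityMeasure ν
  nonneg : ν (Set.Iio 0) = 0
  integrable : ∀ n : ℕ, 1 ≤ n → Integrable (fun x : ℝ => x ^ n) ν
  moment_eq : ∀ n : ℕ, 1 ≤ n → ∫ x, x ^ n ∂ν = m n

/-- `(m n)`, `n ≥ 1`, is the moment sequence of a (strictly) positive random variable. -/
def IsMomentSequence (m : ℕ → ℝ) : Prop :=
  ∃ ν : Measure ℝ, IsMomentLaw m ν ∧ ν {0} = 0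

/-- All positive real powers of the sequence are moment sequences of positive random variables
(in particular the sequence itself, with exponent `1`). -/
def IsInfinitelyDivisible (m : ℕ → ℝ) : Prop :=
  ∀ t : ℝ, 0 < t → IsMomentSequence (fun n => m n ^ t)

/-- Determinacy in the sense of Stieltjes: the moment sequence belongs to a positive random
variable, and no two distinct laws on `[0, ∞)` have it as moment sequence. -/
def IsMomentDeterminate (m : ℕ → ℝ) : Prop :=
  IsMomentSequence m ∧ ∀ ν ν' : Measure ℝ, IsMomentLaw m ν → IsMomentLaw m ν' → ν = ν'

/-- The ratio `Γ(a + s x) Γ(a + b) / (Γ(a) Γ(a + b + s x))`. Its values at `x = n` form the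
Gamma moment sequence of order 2 with parameters `a, b, s`. -/
noncomputable def gammaRatio (a b s x : ℝ) : ℝ :=
  Real.Gamma (a + s * x) * Real.Gamma (a + b) / (Real.Gamma a * Real.Gamma (a + b + s * x))

end StieltjesMoment

/-!
**Existence.** A positive variable is constructed through its logarithm, from the values of the
moment generating function at real arguments. Malmsten's formula, obtained here from the
Bohr–Mollerup theorem and Frullani's integral, writes `Γ(a + s z) / Γ(a)` as
`exp (c z + ∫ (exp (-z u) - 1 + z u) κ(u) du)` over `(0, ∞)`, with the Lévy density
`κ(u) = exp (-(a / s) u) / (u (1 - exp (-u / s)))`, called `gammaLevy a s`. Powers and quotients of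
such functions correspond to real linear combinations of the densities. Whenever such a combination
is nonnegative it is the Lévy density of a law on `ℝ`, a weak limit of compensated compound Poisson
laws (`exists_law_of_levyDensity`), and `exp` turns this law into a positive random variable
(`exists_law_gamma_quotient`). For `gammaRatio a b s` the density
is `gammaLevy a s - gammaLevy (a + b) s ≥ 0`.

**Determinacy.** If `m n` is at most of the order `Dⁿ (2n)!`, then `√X` with a random sign has
exponential moments near `0`, given by a power series in the `m n`; its generating function extends
analytically to a strip, so its characteristic function, and with it the law of `X`, is determined
(`momentLaw_unique`). The sequences built from `gammaRatio` grow at most geometrically, and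
`(Γ(a + s n) / Γ(a)) ^ t` satisfies the bound exactly when `s t ≤ 2`.

**Indeterminacy for `s t > 2`.** The inequality `gammaLevy (t a + 1) (s t) ≤ t gammaLevy a s`
(`gammaLevy_mul_le`) shows that `(Γ(a + s n) / Γ(a)) ^ t` is the product of the moments of
`U ^ (s t)`, where `U` has the `Gamma(t a + 1)` law, and of the moments of a positive variable that
may be taken independent of `U`. As `s t > 2`, Stieltjes' construction applies to the first factor:
multiplying the density of `U` by `1 + cos (u tan θ - φ)` with `θ = π / (s t)` and a suitable phase
`φ` preserves all moments of `U ^ (s t)` of integral order, but changes the one of order `1 / 2`.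
The latter remains visible after multiplication by the independent factor
(`exists_ne_momentLaw`).
-/

namespace StieltjesMoment

/-! ### Compound Poisson laws -/

/-- If the Lebesgue integral of `exp (z x)` is a real number, so is the Bochner integral. -/
lemma exp_moment_of_lintegral {ρ : Measure ℝ} {z E : ℝ} (hE : 0 ≤ E)
    (h : ∫⁻ x, ENNReal.ofReal (Real.exp (z * x)) ∂ρ = ENNReal.ofReal E) :
    Integrable (fun x => Real.exp (z * x)) ρ ∧ ∫ x, Real.exp (z * x) ∂ρ = E := by
  have hm : Measurable (fun x : ℝ => Real.exp (z * x)) := by fun_prop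
  constructor
  · refine ⟨hm.aestronglyMeasurable, ?_⟩
    rw [hasFiniteIntegral_iff_ofReal (Eventually.of_forall fun x => (Real.exp_pos _).le), h]
    exact ENNReal.ofReal_lt_top
  · rw [integral_eq_lintegral_of_nonneg_ae (Eventually.of_forall fun x => (Real.exp_pos _).le)
      hm.aestronglyMeasurable, h, ENNReal.toReal_ofReal hE]

/-- The `n`-fold convolution power of a measure on the line. -/
noncomputable def convPow (η : Measure ℝ) : ℕ → Measure ℝ
  | 0 => Measure.dirac 0
  | n + 1 => (convPow η n).conv η

instance isFiniteMeasure_convPow (η : Measure ℝ) [IsFiniteMeasure η] (n : ℕ) :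
    IsFiniteMeasure (convPow η n) := by
  induction n with
  | zero => unfold convPow; infer_instance
  | succ n ih => unfold convPow; infer_instance

lemma lintegral_exp_convPow (η : Measure ℝ) [IsFiniteMeasure η] (z : ℝ) (n : ℕ) :
    ∫⁻ x, ENNReal.ofReal (Real.exp (z * x)) ∂(convPow η n)
      = (∫⁻ x, ENNReal.ofReal (Real.exp (z * x)) ∂η) ^ n := by
  have hm : Measurable (fun x : ℝ => ENNReal.ofReal (Real.exp (z * x))) := by fun_prop
  induction n with
  | zero => simp [convPow, lintegral_dirac' _ hm]
  | succ n ih =>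
    rw [convPow, Measure.lintegral_conv hm, pow_succ, ← ih, ← lintegral_mul_const _ hm]
    refine lintegral_congr fun x => ?_
    rw [← lintegral_const_mul _ hm]
    refine lintegral_congr fun y => ?_
    rw [← ENNReal.ofReal_mul (Real.exp_pos _).le, ← Real.exp_add, mul_add]

/-- Existence of the compound Poisson law with finite jump measure `η`. -/
lemma exists_compoundPoisson (η : Measure ℝ) [IsFiniteMeasure η] :
    ∃ ρ : Measure ℝ, IsProbabilityMeasure ρ ∧ ∀ z : ℝ, Integrable (fun x => Real.exp (z * x)) η →
      Integrable (fun x => Real.exp (z * x)) ρ ∧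
        ∫ x, Real.exp (z * x) ∂ρ = Real.exp (∫ x, (Real.exp (z * x) - 1) ∂η) := by
  set ρ : Measure ℝ := ENNReal.ofReal (Real.exp (-η.real Set.univ)) •
    Measure.sum (fun n : ℕ => ENNReal.ofReal ((n.factorial : ℝ)⁻¹) • convPow η n) with hρ
  have key : ∀ z : ℝ, Integrable (fun x => Real.exp (z * x)) η →
      ∫⁻ x, ENNReal.ofReal (Real.exp (z * x)) ∂ρ
        = ENNReal.ofReal (Real.exp (∫ x, (Real.exp (z * x) - 1) ∂η)) := by
    intro z hz
    set J := ∫ x, Real.exp (z * x) ∂η with hJ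
    have hJ0 : 0 ≤ J := integral_nonneg fun x => (Real.exp_pos _).le
    have hI : ∫⁻ x, ENNReal.ofReal (Real.exp (z * x)) ∂η = ENNReal.ofReal J :=
      (ofReal_integral_eq_lintegral_ofReal hz
        (Eventually.of_forall fun x => (Real.exp_pos _).le)).symm
    have hterm : ∀ n : ℕ, ENNReal.ofReal ((n.factorial : ℝ)⁻¹) * (ENNReal.ofReal J) ^ n
        = ENNReal.ofReal (J ^ n / n.factorial) := by
      intro n
      rw [← ENNReal.ofReal_pow hJ0, ← ENNReal.ofReal_mul (by positivity), div_eq_inv_mul]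
    rw [hρ, lintegral_smul_measure, lintegral_sum_measure]
    simp only [lintegral_smul_measure, lintegral_exp_convPow, hI, smul_eq_mul, hterm]
    rw [← ENNReal.ofReal_tsum_of_nonneg (fun n => by positivity)
        (Real.summable_pow_div_factorial J),
      ← ENNReal.ofReal_mul (Real.exp_pos _).le, integral_sub hz (integrable_const _)]
    have : ∑' n : ℕ, J ^ n / n.factorial = Real.exp J := by
      rw [Real.exp_eq_exp_ℝ, NormedSpace.exp_eq_tsum_div]
    rw [this, ← Real.exp_add]
    congr 2
    simp [hJ]
    ring
  refine ⟨ρ, ⟨?_⟩, fun z hz => exp_moment_of_lintegral (Real.exp_pos _).le (key z hz)⟩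
  have h0 := key 0 (by simp)
  simpa using h0

/-! ### A continuity theorem for moment generating functions -/

/-- A tightness bound from exponential moments at `±δ`. -/
lemma measureReal_abs_gt_le {ρ : Measure ℝ} [IsProbabilityMeasure ρ] {δ r : ℝ} (hδ : 0 < δ)
    (h₁ : Integrable (fun x => Real.exp (δ * x)) ρ)
    (h₂ : Integrable (fun x => Real.exp (-δ * x)) ρ) :
    ρ.real {x | r < ‖x‖} ≤ Real.exp (-δ * r) *
      (∫ x, Real.exp (δ * x) ∂ρ + ∫ x, Real.exp (-δ * x) ∂ρ) := by
  have e₁ := ProbabilityTheory.measure_ge_le_exp_mul_mgf (X := id) (μ := ρ) r hδ.le h₁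
  have e₂ := ProbabilityTheory.measure_le_le_exp_mul_mgf (X := id) (μ := ρ) (-r)
    (t := -δ) (by linarith) h₂
  have hsub : {x : ℝ | r < ‖x‖} ⊆ {x | r ≤ id x} ∪ {x | id x ≤ -r} := by
    intro x hx
    simp only [Set.mem_ofPred_eq, Real.norm_eq_abs, Set.mem_union, id] at *
    rcases lt_abs.1 hx with h | h
    · left; exact h.le
    · right; linarith
  refine (measureReal_mono hsub).trans ((measureReal_union_le _ _).trans ?_)
  rw [mul_add]
  refine add_le_add e₁ (e₂.trans (le_of_eq ?_))
  simp [ProbabilityTheory.mgf]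

/-- Continuity theorem for moment generating functions, in the form that yields existence of the
limit law: the exponential moments at `±δ` give tightness, and those at `2z` give uniform
integrability of `exp (z x)`. -/
lemma exists_law_of_tendsto_exp_moment (ρ : ℕ → ProbabilityMeasure ℝ) (M : ℝ → ℝ) {δ : ℝ}
    (hδ : 0 < δ)
    (hint : ∀ n, ∀ z, -δ ≤ z → Integrable (fun x => Real.exp (z * x)) (ρ n : Measure ℝ))
    (hlim : ∀ z, -δ ≤ z → Tendsto (fun n => ∫ x, Real.exp (z * x) ∂(ρ n : Measure ℝ)) atTop
      (𝓝 (M z))) :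
    ∃ ρ' : Measure ℝ, IsProbabilityMeasure ρ' ∧ ∀ z, 0 ≤ z →
      Integrable (fun x => Real.exp (z * x)) ρ' ∧ ∫ x, Real.exp (z * x) ∂ρ' = M z := by
  have hbdd : ∀ z, -δ ≤ z → ∃ B, ∀ n, ∫ x, Real.exp (z * x) ∂(ρ n : Measure ℝ) ≤ B := by
    intro z hz
    obtain ⟨B, hB⟩ := (hlim z hz).bddAbove_range
    exact ⟨B, fun n => hB ⟨n, rfl⟩⟩
  have htight :
      IsTightMeasureSet {((μ : ProbabilityMeasure ℝ) : Measure ℝ) | μ ∈ Set.range ρ} := by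
    obtain ⟨B₁, hB₁⟩ := hbdd δ (by linarith)
    obtain ⟨B₂, hB₂⟩ := hbdd (-δ) le_rfl
    refine isTightMeasureSet_of_tendsto_measure_norm_gt ?_
    have hto : Tendsto (fun r : ℝ => ENNReal.ofReal (Real.exp (-δ * r) * (B₁ + B₂))) atTop
        (𝓝 0) := by
      have : Tendsto (fun r : ℝ => Real.exp (-δ * r) * (B₁ + B₂)) atTop (𝓝 (0 * (B₁ + B₂))) := by
        refine Tendsto.mul_const _ (Real.tendsto_exp_atBot.comp ?_)
        exact tendsto_id.const_mul_atTop_of_neg (by linarith)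
      rw [zero_mul] at this
      simpa using ENNReal.tendsto_ofReal this
    refine tendsto_of_tendsto_of_tendsto_of_le_of_le tendsto_const_nhds hto
      (fun r => zero_le) fun r => ?_
    refine iSup₂_le ?_
    rintro _ ⟨_, ⟨n, rfl⟩, rfl⟩
    rw [← ofReal_measureReal]
    refine ENNReal.ofReal_le_ofReal ((measureReal_abs_gt_le hδ (hint n δ (by linarith))
      (hint n (-δ) le_rfl)).trans ?_)
    gcongr
    · exact hB₁ n
    · exact hB₂ n
  have hcomp := isCompact_closure_of_isTightMeasureSet htight
  -- a limit along an ultrafilter replaces the extraction of a subsequence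
  set U : Ultrafilter ℕ := Ultrafilter.of atTop with hU
  have hUle : (U : Filter ℕ) ≤ atTop := Ultrafilter.of_le atTop
  obtain ⟨ρ', -, hρ'⟩ := hcomp.ultrafilter_le_nhds (U.map ρ) (by
    rw [le_principal_iff]
    exact Filter.mem_map.2 (Filter.univ_mem' fun n => subset_closure ⟨n, rfl⟩))
  have hconv : Tendsto ρ (U : Filter ℕ) (𝓝 ρ') := hρ'
  rw [ProbabilityMeasure.tendsto_iff_forall_integral_tendsto] at hconv
  refine ⟨ρ', inferInstance, fun z hz => ?_⟩
  have hM0 : 0 ≤ M z := ge_of_tendsto' (hlim z (by linarith))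
    fun n => integral_nonneg fun x => (Real.exp_pos _).le
  obtain ⟨B, hB⟩ := hbdd (2 * z) (by linarith)
  -- the truncated exponential, a bounded continuous function
  let f : ℕ → BoundedContinuousFunction ℝ ℝ := fun R =>
    BoundedContinuousFunction.ofNormedAddCommGroup
      (fun x => min (Real.exp (z * x)) ((R : ℝ) + 1)) (by fun_prop) ((R : ℝ) + 1) (fun x => by
        rw [Real.norm_of_nonneg (le_min (Real.exp_pos _).le (by positivity))]
        exact min_le_right _ _)
  have hfv : ∀ R x, f R x = min (Real.exp (z * x)) ((R : ℝ) + 1) := fun R x => rfl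
  have hle : ∀ R : ℕ, ∫ x, f R x ∂(ρ' : Measure ℝ) ≤ M z := by
    intro R
    refine le_of_tendsto_of_tendsto (hconv (f R)) ((hlim z (by linarith)).mono_left hUle)
      (Eventually.of_forall fun n => ?_)
    exact integral_mono ((f R).integrable _) (hint n z (by linarith)) fun x => min_le_left _ _
  -- the part cut off is at most `exp (2 z x) / (R + 1)`
  have hge : ∀ R : ℕ, M z - B / ((R : ℝ) + 1) ≤ ∫ x, f R x ∂(ρ' : Measure ℝ) := by
    intro R
    refine le_of_tendsto_of_tendsto (((hlim z (by linarith)).mono_left hUle).sub_const _)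
      (hconv (f R)) (Eventually.of_forall fun n => ?_)
    have hR : (0 : ℝ) < (R : ℝ) + 1 := by positivity
    have h2 := hint n (2 * z) (by linarith)
    have : ∫ x, Real.exp (z * x) ∂(ρ n : Measure ℝ)
        ≤ ∫ x, (f R x + Real.exp (2 * z * x) / ((R : ℝ) + 1)) ∂(ρ n : Measure ℝ) := by
      refine integral_mono (hint n z (by linarith)) (((f R).integrable _).add (h2.div_const _))
        fun x => ?_
      have he : Real.exp (2 * z * x) = Real.exp (z * x) * Real.exp (z * x) := by
        rw [← Real.exp_add]; ring_nf
      have hp := Real.exp_pos (z * x)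
      simp only [hfv, he]
      rcases le_total (Real.exp (z * x)) ((R : ℝ) + 1) with h | h
      · rw [min_eq_left h]
        have : 0 ≤ Real.exp (z * x) * Real.exp (z * x) / ((R : ℝ) + 1) := by positivity
        linarith
      · rw [min_eq_right h]
        have : Real.exp (z * x) ≤ Real.exp (z * x) * Real.exp (z * x) / ((R : ℝ) + 1) := by
          rw [le_div_iff₀ hR]
          gcongr
        linarith
    rw [integral_add ((f R).integrable _) (h2.div_const _), integral_div] at this
    have hb : (∫ x, Real.exp (2 * z * x) ∂(ρ n : Measure ℝ)) / ((R : ℝ) + 1)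
        ≤ B / ((R : ℝ) + 1) := by
      gcongr
      exact hB n
    simp only
    linarith
  have hlimR : Tendsto (fun R : ℕ => ∫ x, f R x ∂(ρ' : Measure ℝ)) atTop (𝓝 (M z)) := by
    refine tendsto_of_tendsto_of_tendsto_of_le_of_le ?_ tendsto_const_nhds hge hle
    have : Tendsto (fun R : ℕ => M z - B / ((R : ℝ) + 1)) atTop (𝓝 (M z - 0)) :=
      tendsto_const_nhds.sub
        (tendsto_const_nhds.div_atTop
          (tendsto_atTop_add_const_right _ _ tendsto_natCast_atTop_atTop))
    simpa using this
  refine exp_moment_of_lintegral hM0 ?_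
  have hmono : Tendsto (fun R : ℕ => ∫⁻ x, ENNReal.ofReal (f R x) ∂(ρ' : Measure ℝ)) atTop
      (𝓝 (∫⁻ x, ENNReal.ofReal (Real.exp (z * x)) ∂(ρ' : Measure ℝ))) := by
    refine lintegral_tendsto_of_tendsto_of_monotone (fun R => ?_) ?_ ?_
    · exact ((f R).continuous.measurable.ennreal_ofReal).aemeasurable
    · refine Eventually.of_forall fun x R S hRS => ENNReal.ofReal_le_ofReal ?_
      simp only [hfv]
      have : (R : ℝ) ≤ S := by exact_mod_cast hRS
      gcongr
    · refine Eventually.of_forall fun x => ENNReal.tendsto_ofReal ?_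
      refine tendsto_const_nhds.congr' ?_
      filter_upwards [eventually_ge_atTop ⌈Real.exp (z * x)⌉₊] with R hR
      rw [hfv, min_eq_left]
      have := Nat.ceil_le.1 hR
      linarith
  refine tendsto_nhds_unique hmono ?_
  have : ∀ R : ℕ, ∫⁻ x, ENNReal.ofReal (f R x) ∂(ρ' : Measure ℝ)
      = ENNReal.ofReal (∫ x, f R x ∂(ρ' : Measure ℝ)) := fun R =>
    (ofReal_integral_eq_lintegral_ofReal ((f R).integrable _)
      (Eventually.of_forall fun x => le_min (Real.exp_pos _).le (by positivity))).symm
  simp only [this]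
  exact ENNReal.tendsto_ofReal hlimR

/-! ### Laws with a prescribed Lévy density -/

lemma exp_neg_sub_one_add_nonneg (y : ℝ) : 0 ≤ Real.exp (-y) - 1 + y := by
  linarith [Real.add_one_le_exp (-y)]

/-- Taylor bound for the compensated exponential. -/
lemma exp_neg_sub_one_add_le (y : ℝ) : Real.exp (-y) - 1 + y ≤ y ^ 2 * Real.exp |y| := by
  have h := Complex.norm_exp_sub_sum_le_norm_mul_exp ((-y : ℝ) : ℂ) 2
  simp only [Finset.sum_range_succ, Finset.range_zero, Finset.sum_empty, pow_zero, Nat.factorial,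
    pow_one] at h
  have e : Complex.exp ((-y : ℝ) : ℂ)
      - (0 + 1 / ((1 : ℕ) : ℂ) + ((-y : ℝ) : ℂ) / (((0 + 1) * 1 : ℕ) : ℂ))
      = ((Real.exp (-y) - 1 + y : ℝ) : ℂ) := by
    push_cast; ring
  rw [e, Complex.norm_real, Complex.norm_real, norm_neg, Real.norm_eq_abs, Real.norm_eq_abs,
    sq_abs] at h
  exact (le_abs_self _).trans h

/-- Sharper bound, without loss of exponential growth on the side where `exp (-y)` is bounded. -/
lemma exp_neg_sub_one_add_le_max (y : ℝ) :
    Real.exp (-y) - 1 + y ≤ y ^ 2 * max 1 (Real.exp (-y)) := by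
  rcases le_total 0 y with hy | hy
  · rcases le_total y 1 with h1 | h1
    · have := Real.abs_exp_sub_one_sub_id_le (x := -y) (by
        rw [abs_neg, abs_of_nonneg hy]; exact h1)
      have h2 := le_abs_self (Real.exp (-y) - 1 - -y)
      have h3 : y ^ 2 * 1 ≤ y ^ 2 * max 1 (Real.exp (-y)) := by gcongr; exact le_max_left _ _
      nlinarith
    · have h3 : y ^ 2 * 1 ≤ y ^ 2 * max 1 (Real.exp (-y)) := by gcongr; exact le_max_left _ _
      have h4 : Real.exp (-y) ≤ 1 := Real.exp_le_one_iff.2 (by linarith)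
      nlinarith
  · have h := exp_neg_sub_one_add_le y
    rw [abs_of_nonpos hy] at h
    exact h.trans (by gcongr; exact le_max_right _ _)

lemma max_one_exp_neg_le {z x δ : ℝ} (hx : 0 < x) (hδ : 0 ≤ δ) (hz : -δ ≤ z) :
    max 1 (Real.exp (-(z * x))) ≤ Real.exp (δ * x) := by
  refine max_le (Real.one_le_exp (by positivity)) (Real.exp_le_exp.2 ?_)
  nlinarith

/-- Compensated exponentials are integrable against a Lévy density with `x⁻²` singularity at `0`
and exponential decay at infinity. -/
lemma integrableOn_compensated {κ : ℝ → ℝ} {C δ z : ℝ} (hκ : Measurable κ) (hδ : 0 < δ)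
    (hb : ∀ x, 0 < x → |κ x| ≤ C * Real.exp (-δ * x) / x ^ 2) (hz : -δ < z) :
    IntegrableOn (fun x => (Real.exp (-(z * x)) - 1 + z * x) * κ x) (Set.Ioi 0) := by
  set d := max 0 (-z) with hd
  have hdδ : d < δ := max_lt hδ (by linarith)
  have hd0 : 0 ≤ d := le_max_left _ _
  have hdz : -d ≤ z := by linarith [le_max_right 0 (-z)]
  have hg : IntegrableOn (fun x => z ^ 2 * C * Real.exp (-(δ - d) * x)) (Set.Ioi 0) :=
    (integrableOn_exp_mul_Ioi (by linarith : -(δ - d) < 0) 0).const_mul (z ^ 2 * C)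
  refine Integrable.mono' hg (by fun_prop) ?_
  filter_upwards [ae_restrict_mem measurableSet_Ioi] with x hx
  have hx : 0 < x := hx
  rw [norm_mul, Real.norm_of_nonneg (exp_neg_sub_one_add_nonneg _), Real.norm_eq_abs]
  have h1 := exp_neg_sub_one_add_le_max (z * x)
  have h2 := max_one_exp_neg_le hx hd0 hdz
  calc (Real.exp (-(z * x)) - 1 + z * x) * |κ x|
      ≤ ((z * x) ^ 2 * Real.exp (d * x)) * (C * Real.exp (-δ * x) / x ^ 2) := by
        refine mul_le_mul (h1.trans (by gcongr)) (hb x hx) (abs_nonneg _) (by positivity)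
    _ = z ^ 2 * C * (Real.exp (d * x) * Real.exp (-δ * x)) := by field_simp
    _ = z ^ 2 * C * Real.exp (-(δ - d) * x) := by rw [← Real.exp_add]; ring_nf

/-- Existence half of the Lévy–Khinchine theorem for spectrally negative laws whose Lévy density
has an `x⁻²` singularity at `0` and exponential decay. The law is the weak limit of compensated
compound Poisson laws with jumps of size at least `1 / (N + 1)`. -/
lemma exists_law_of_levyDensity {κ : ℝ → ℝ} {C δ : ℝ} (c : ℝ) (hκ : Measurable κ) (hδ : 0 < δ)
    (h0 : ∀ x, 0 < x → 0 ≤ κ x)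
    (hb : ∀ x, 0 < x → κ x ≤ C * Real.exp (-(2 * δ) * x) / x ^ 2) :
    ∃ ρ : Measure ℝ, IsProbabilityMeasure ρ ∧ ∀ z, 0 ≤ z →
      Integrable (fun x => Real.exp (z * x)) ρ ∧ ∫ x, Real.exp (z * x) ∂ρ
        = Real.exp (c * z + ∫ x in Set.Ioi 0, (Real.exp (-(z * x)) - 1 + z * x) * κ x) := by
  have hb' : ∀ x, 0 < x → |κ x| ≤ C * Real.exp (-(2 * δ) * x) / x ^ 2 := fun x hx => by
    rw [abs_of_nonneg (h0 x hx)]; exact hb x hx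
  have hpos : ∀ N : ℕ, (0 : ℝ) < 1 / ((N : ℝ) + 1) := fun N => by positivity
  have hsub : ∀ N : ℕ, Set.Ioi (1 / ((N : ℝ) + 1)) ⊆ Set.Ioi (0 : ℝ) := fun N =>
    Set.Ioi_subset_Ioi (hpos N).le
  -- integrability of `exp (-z x) κ x` away from `0`
  have hexp : ∀ (N : ℕ) (z : ℝ), -δ ≤ z →
      IntegrableOn (fun x => Real.exp (-(z * x)) * κ x) (Set.Ioi (1 / ((N : ℝ) + 1))) := by
    intro N z hz
    have hg : IntegrableOn (fun x => C * ((N : ℝ) + 1) ^ 2 * Real.exp (-δ * x))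
        (Set.Ioi (1 / ((N : ℝ) + 1))) :=
      (integrableOn_exp_mul_Ioi (by linarith : -δ < 0) _).const_mul _
    refine Integrable.mono' hg (by fun_prop) ?_
    filter_upwards [ae_restrict_mem measurableSet_Ioi] with x hx
    have hx' : 1 / ((N : ℝ) + 1) < x := hx
    have hx0 : 0 < x := (hpos N).trans hx'
    rw [norm_mul, Real.norm_of_nonneg (Real.exp_pos _).le, Real.norm_eq_abs]
    have h2 := (le_max_right _ _).trans (max_one_exp_neg_le hx0 hδ.le hz)
    have h3 := hb' x hx0
    have hC : 0 ≤ C * Real.exp (-(2 * δ) * x) := by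
      have := (abs_nonneg _).trans h3
      rw [div_nonneg_iff] at this
      rcases this with h | h
      · exact h.1
      · nlinarith [sq_pos_of_pos hx0]
    have h4 : 1 / x ^ 2 ≤ ((N : ℝ) + 1) ^ 2 := by
      rw [← one_div_one_div ((N : ℝ) + 1), one_div_pow]
      gcongr
    calc Real.exp (-(z * x)) * |κ x|
        ≤ Real.exp (δ * x) * ((C * Real.exp (-(2 * δ) * x)) * (1 / x ^ 2)) := by
          rw [mul_one_div]; gcongr
      _ ≤ Real.exp (δ * x) * ((C * Real.exp (-(2 * δ) * x)) * ((N : ℝ) + 1) ^ 2) := by gcongr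
      _ = C * ((N : ℝ) + 1) ^ 2 * (Real.exp (δ * x) * Real.exp (-(2 * δ) * x)) := by ring
      _ = C * ((N : ℝ) + 1) ^ 2 * Real.exp (-δ * x) := by rw [← Real.exp_add]; ring_nf
  have hone : ∀ N : ℕ, IntegrableOn κ (Set.Ioi (1 / ((N : ℝ) + 1))) := fun N => by
    simpa using hexp N 0 (by linarith)
  -- `z x` is a combination of the compensated exponential, `exp (-z x)` and `1`, here for `z = δ`
  have hlin : ∀ N : ℕ, IntegrableOn (fun x => x * κ x) (Set.Ioi (1 / ((N : ℝ) + 1))) := by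
    intro N
    have h := ((integrableOn_compensated (z := δ) hκ (by linarith) hb' (by linarith)).mono_set
      (hsub N)).sub (hexp N δ (by linarith)) |>.add (hone N)
    refine (h.const_mul δ⁻¹).congr (Eventually.of_forall fun x => ?_)
    simp only [Pi.add_apply, Pi.sub_apply]
    field_simp
    ring
  -- the law with jumps larger than `1 / (N + 1)`, of mean `c`
  have key : ∀ N : ℕ, ∃ ρ : ProbabilityMeasure ℝ, ∀ z, -δ ≤ z →
      Integrable (fun x => Real.exp (z * x)) (ρ : Measure ℝ) ∧
      ∫ x, Real.exp (z * x) ∂(ρ : Measure ℝ) = Real.exp (c * z +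
        ∫ x in Set.Ioi (1 / ((N : ℝ) + 1)), (Real.exp (-(z * x)) - 1 + z * x) * κ x) := by
    intro N
    set S := Set.Ioi (1 / ((N : ℝ) + 1)) with hS
    set η : Measure ℝ := (volume.restrict S).withDensity (fun x => ENNReal.ofReal (κ x)) with hη
    have hae : ∀ᵐ x ∂(volume.restrict S), 0 ≤ κ x := by
      filter_upwards [ae_restrict_mem measurableSet_Ioi] with x hx using h0 x (hsub N hx)
    have hfin : IsFiniteMeasure η := isFiniteMeasure_withDensity_ofReal (hone N).2
    have hηint : ∀ f : ℝ → ℝ, ∫ x, f x ∂η = ∫ x in S, f x * κ x := by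
      intro f
      rw [hη, integral_withDensity_eq_integral_toReal_smul (by fun_prop)
        (Eventually.of_forall fun x => ENNReal.ofReal_lt_top)]
      refine integral_congr_ae ?_
      filter_upwards [hae] with x hx
      rw [ENNReal.toReal_ofReal hx, smul_eq_mul, mul_comm]
    have hηI : ∀ f : ℝ → ℝ, IntegrableOn (fun x => f x * κ x) S → Integrable f η := by
      intro f hf
      rw [hη, integrable_withDensity_iff (by fun_prop)
        (Eventually.of_forall fun x => ENNReal.ofReal_lt_top)]
      refine hf.congr ?_
      filter_upwards [hae] with x hx
      rw [ENNReal.toReal_ofReal hx]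
    obtain ⟨ρ, hρ, hρz⟩ := exists_compoundPoisson η
    set b := c + ∫ x in S, x * κ x with hb
    have hT : Measurable (fun y : ℝ => b - y) := by fun_prop
    refine ⟨⟨ρ.map (fun y => b - y), Measure.isProbabilityMeasure_map hT.aemeasurable⟩,
      fun z hz => ?_⟩
    have hI : Integrable (fun x => Real.exp (-z * x)) η := by
      refine hηI _ ?_
      simpa only [neg_mul] using hexp N z hz
    obtain ⟨i1, i2⟩ := hρz (-z) hI
    have hsplit : ∀ y, Real.exp (z * (b - y)) = Real.exp (b * z) * Real.exp (-z * y) := fun y => by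
      rw [← Real.exp_add]; ring_nf
    have hmz : Measurable (fun x : ℝ => Real.exp (z * x)) := by fun_prop
    simp only [ProbabilityMeasure.coe_mk]
    constructor
    · rw [integrable_map_measure hmz.aestronglyMeasurable hT.aemeasurable]
      simp only [Function.comp_def, hsplit]
      exact i1.const_mul _
    · rw [integral_map hT.aemeasurable hmz.aestronglyMeasurable]
      simp only [hsplit]
      rw [integral_const_mul, i2, ← Real.exp_add, hηint]
      congr 1
      have e : (fun x => (Real.exp (-(z * x)) - 1 + z * x) * κ x)
          = fun x => (Real.exp (-z * x) - 1) * κ x + z * (x * κ x) := by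
        funext x; rw [neg_mul]; ring
      have hIs : IntegrableOn (fun x => (Real.exp (-z * x) - 1) * κ x) S := by
        refine ((hexp N z hz).sub (hone N)).congr (Eventually.of_forall fun x => ?_)
        simp only [Pi.sub_apply, neg_mul]
        ring
      rw [e, integral_add hIs ((hlin N).const_mul z), integral_const_mul, hb]
      ring
  choose ρ hρ using key
  refine exists_law_of_tendsto_exp_moment ρ _ hδ (fun n z hz => (hρ n z hz).1) fun z hz => ?_
  simp only [fun n => (hρ n z hz).2]
  refine (Real.continuous_exp.tendsto _).comp (tendsto_const_nhds.add ?_)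
  have hU : ⋃ N : ℕ, Set.Ioi (1 / ((N : ℝ) + 1)) = Set.Ioi (0 : ℝ) := by
    refine Set.Subset.antisymm (Set.iUnion_subset hsub) fun x hx => ?_
    obtain ⟨n, hn⟩ := exists_nat_one_div_lt (show (0 : ℝ) < x from hx)
    exact Set.mem_iUnion.2 ⟨n, hn⟩
  have hmono : Monotone fun N : ℕ => Set.Ioi (1 / ((N : ℝ) + 1)) := fun N M h =>
    Set.Ioi_subset_Ioi (one_div_le_one_div_of_le (by positivity) (by gcongr))
  rw [← hU]
  exact tendsto_setIntegral_of_monotone (fun N => measurableSet_Ioi) hmono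
    (by rw [hU]; exact integrableOn_compensated hκ (by linarith) hb' (by linarith))

/-! ### The Lévy–Khinchine representation of the Gamma function -/

/-- The Lévy density of (minus) the logarithm of the `s`-th power of a `Gamma(a)` variable. -/
noncomputable def gammaLevy (a s u : ℝ) : ℝ :=
  Real.exp (-(a / s) * u) / (u * (1 - Real.exp (-(u / s))))

lemma measurable_gammaLevy (a s : ℝ) : Measurable (gammaLevy a s) := by
  unfold gammaLevy; fun_prop

lemma one_sub_exp_neg_pos {v : ℝ} (hv : 0 < v) : 0 < 1 - Real.exp (-v) := by
  have : Real.exp (-v) < 1 := Real.exp_lt_one_iff.2 (by linarith)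
  linarith

lemma gammaLevy_nonneg {a s u : ℝ} (hs : 0 < s) (hu : 0 < u) : 0 ≤ gammaLevy a s u := by
  have := one_sub_exp_neg_pos (div_pos hu hs)
  unfold gammaLevy; positivity

/-- From `(1 - exp (-v))⁻¹ ≤ (1 + v) / v`. -/
lemma gammaLevy_le {a s u : ℝ} (hs : 0 < s) (hu : 0 < u) :
    gammaLevy a s u ≤ (s + u) * Real.exp (-(a / s) * u) / u ^ 2 := by
  have hv := div_pos hu hs
  have h1 : u / (s + u) ≤ 1 - Real.exp (-(u / s)) := by
    have := Real.add_one_le_exp (u / s)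
    rw [Real.exp_neg]
    have h2 : (Real.exp (u / s))⁻¹ ≤ (u / s + 1)⁻¹ := by gcongr
    have h3 : (u / s + 1)⁻¹ = 1 - u / (s + u) := by field_simp; ring
    linarith
  unfold gammaLevy
  calc Real.exp (-(a / s) * u) / (u * (1 - Real.exp (-(u / s))))
      ≤ Real.exp (-(a / s) * u) / (u * (u / (s + u))) := by gcongr
    _ = (s + u) * Real.exp (-(a / s) * u) / u ^ 2 := by field_simp

/-- From `(1 - exp (-v))⁻¹ ≥ 1 / v`. -/
lemma le_gammaLevy {a s u : ℝ} (hs : 0 < s) (hu : 0 < u) :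
    s * Real.exp (-(a / s) * u) / u ^ 2 ≤ gammaLevy a s u := by
  have hv := div_pos hu hs
  have h1 := one_sub_exp_neg_pos hv
  have h2 : 1 - Real.exp (-(u / s)) ≤ u / s := by linarith [Real.add_one_le_exp (-(u / s))]
  unfold gammaLevy
  calc s * Real.exp (-(a / s) * u) / u ^ 2 = Real.exp (-(a / s) * u) / (u * (u / s)) := by
        field_simp
    _ ≤ _ := by gcongr

lemma exists_gammaLevy_bound {a s δ : ℝ} (hs : 0 < s) (hδ : δ < a / s) :
    ∃ C, 0 ≤ C ∧ ∀ u, 0 < u → gammaLevy a s u ≤ C * Real.exp (-δ * u) / u ^ 2 := by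
  set ε := a / s - δ with hε
  have hε0 : 0 < ε := by linarith
  refine ⟨s + 1 / ε, by positivity, fun u hu => (gammaLevy_le hs hu).trans ?_⟩
  have h1 : u * Real.exp (-ε * u) ≤ 1 / ε := by
    have := Real.add_one_le_exp (ε * u)
    rw [neg_mul, Real.exp_neg, ← div_eq_mul_inv, div_le_div_iff₀ (Real.exp_pos _) hε0]
    linarith
  have h2 : Real.exp (-ε * u) ≤ 1 := Real.exp_le_one_iff.2 (by nlinarith)
  have h3 : Real.exp (-(a / s) * u) = Real.exp (-ε * u) * Real.exp (-δ * u) := by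
    rw [← Real.exp_add, hε]; ring_nf
  rw [h3, ← mul_assoc]
  gcongr
  nlinarith

/-- The compensated exponential integral against the Lévy density `gammaLevy a 1`, in the variable
`y = a + z`, in which it is `log Γ(y)` up to an affine function. -/
noncomputable def levyExponent (a y : ℝ) : ℝ :=
  ∫ x in Set.Ioi 0, (Real.exp (-((y - a) * x)) - 1 + (y - a) * x) * gammaLevy a 1 x

lemma integrableOn_levyExponent {a y : ℝ} (ha : 0 < a) (hy : 0 < y) :
    IntegrableOn (fun x => (Real.exp (-((y - a) * x)) - 1 + (y - a) * x) * gammaLevy a 1 x)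
      (Set.Ioi 0) := by
  have hm := min_le_left a y
  have hm' := min_le_right a y
  have hm0 : 0 < min a y := lt_min ha hy
  -- a rate below the decay rate `a` of the density, but above `a - y`
  obtain ⟨C, -, hC⟩ := exists_gammaLevy_bound (a := a) (δ := a - min a y / 2) one_pos
    (by rw [div_one]; linarith)
  refine integrableOn_compensated (C := C) (measurable_gammaLevy a 1) (δ := a - min a y / 2)
    (by linarith) (fun x hx => ?_) (by linarith)
  rw [abs_of_nonneg (gammaLevy_nonneg one_pos hx)]
  exact hC x hx

lemma convexOn_levyExponent {a : ℝ} (ha : 0 < a) :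
    ConvexOn ℝ (Set.Ioi 0) (levyExponent a) := by
  refine ⟨convex_Ioi 0, fun x hx y hy p q hp hq hpq => ?_⟩
  have hxy : 0 < p * x + q * y := (convex_Ioi (0 : ℝ)) hx hy hp hq hpq
  simp only [smul_eq_mul]
  unfold levyExponent
  have ix := integrableOn_levyExponent ha (show 0 < x from hx)
  have iy := integrableOn_levyExponent ha (show 0 < y from hy)
  rw [← integral_const_mul, ← integral_const_mul, ← integral_add (ix.const_mul p) (iy.const_mul q)]
  refine setIntegral_mono_on (integrableOn_levyExponent ha hxy)
    ((ix.const_mul p).add (iy.const_mul q)) measurableSet_Ioi fun u hu => ?_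
  have hk := gammaLevy_nonneg (a := a) one_pos (show 0 < u from hu)
  rw [← mul_assoc, ← mul_assoc, ← add_mul]
  refine mul_le_mul_of_nonneg_right ?_ hk
  have hc := convexOn_exp.2 (Set.mem_univ (-((x - a) * u))) (Set.mem_univ (-((y - a) * u)))
    hp hq hpq
  simp only [smul_eq_mul] at hc
  have e : p * -((x - a) * u) + q * -((y - a) * u) = -((p * x + q * y - a) * u) := by
    linear_combination a * u * hpq
  rw [e] at hc
  linear_combination hc + (1 + a * u) * hpq

/-- The increments of `levyExponent` are those of `log Γ` up to a constant: the difference of two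
of them is Frullani's integral for `log`. -/
lemma levyExponent_add_one_sub {a y : ℝ} (ha : 0 < a) (hy : 0 < y) :
    levyExponent a (y + 1) - levyExponent a y
      = Real.log y + (levyExponent a 2 - levyExponent a 1) := by
  have i1 := integrableOn_levyExponent ha (show 0 < y + 1 by linarith)
  have i2 := integrableOn_levyExponent ha hy
  have i3 := integrableOn_levyExponent ha (show (0 : ℝ) < 2 by norm_num)
  have i4 := integrableOn_levyExponent ha (show (0 : ℝ) < 1 by norm_num)
  have hpt : ∀ x ∈ Set.Ioi (0 : ℝ),
      ((Real.exp (-((y + 1 - a) * x)) - 1 + (y + 1 - a) * x) * gammaLevy a 1 x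
        - (Real.exp (-((y - a) * x)) - 1 + (y - a) * x) * gammaLevy a 1 x)
      - ((Real.exp (-((2 - a) * x)) - 1 + (2 - a) * x) * gammaLevy a 1 x
        - (Real.exp (-((1 - a) * x)) - 1 + (1 - a) * x) * gammaLevy a 1 x)
      = x⁻¹ • (Real.exp (-(1 * x)) - Real.exp (-(y * x))) := by
    intro x hx
    have hx0 : 0 < x := hx
    have h1 := one_sub_exp_neg_pos hx0
    have e1 : Real.exp (-((y + 1 - a) * x))
        = Real.exp (-(y * x)) * Real.exp (-x) * Real.exp (a * x) := by
      rw [← Real.exp_add, ← Real.exp_add]; ring_nf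
    have e2 : Real.exp (-((y - a) * x)) = Real.exp (-(y * x)) * Real.exp (a * x) := by
      rw [← Real.exp_add]; ring_nf
    have e3 : Real.exp (-((2 - a) * x)) = Real.exp (-x) * Real.exp (-x) * Real.exp (a * x) := by
      rw [← Real.exp_add, ← Real.exp_add]; ring_nf
    have e4 : Real.exp (-((1 - a) * x)) = Real.exp (-x) * Real.exp (a * x) := by
      rw [← Real.exp_add]; ring_nf
    have e5 : Real.exp (-(a / 1) * x) = (Real.exp (a * x))⁻¹ := by
      rw [← Real.exp_neg]; ring_nf
    rw [e1, e2, e3, e4, gammaLevy, e5, div_one, one_mul, smul_eq_mul]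
    have := Real.exp_pos (a * x)
    field_simp
    ring
  have hI : IntegrableOn (fun x : ℝ => x⁻¹ • (Real.exp (-(1 * x)) - Real.exp (-(y * x))))
      (Set.Ioi 0) :=
    ((i1.sub i2).sub (i3.sub i4)).congr_fun hpt measurableSet_Ioi
  have hF := Frullani.integral_Ioi_eq (f := fun x : ℝ => Real.exp (-x)) (a := 1) (b := y)
    (L := 1) (R := 0)
    ((by fun_prop : Continuous fun x : ℝ => Real.exp (-x)).locallyIntegrable.locallyIntegrableOn _)
    one_pos hy
    (by
      have : Tendsto (fun x : ℝ => Real.exp (-x)) (𝓝 0) (𝓝 (Real.exp (-0))) :=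
        (by fun_prop : Continuous fun x : ℝ => Real.exp (-x)).tendsto 0
      rw [neg_zero, Real.exp_zero] at this
      exact this.mono_left nhdsWithin_le_nhds)
    (Real.tendsto_exp_atBot.comp tendsto_neg_atTop_atBot) hI
  rw [← setIntegral_congr_fun measurableSet_Ioi hpt] at hF
  have h1234 := integral_sub (i1.sub i2) (i3.sub i4)
  have h12 := integral_sub i1 i2
  have h34 := integral_sub i3 i4
  simp only [div_one, sub_zero, smul_eq_mul, mul_one] at hF
  simp only [Pi.sub_apply] at h12 h34 h1234
  simp only [levyExponent]
  linarith

/-- Malmsten's formula, up to a linear term: the right-hand side is log-convex and satisfies the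
functional equation of `Γ`, so the Bohr–Mollerup theorem applies. -/
lemma gamma_eq_exp_levyExponent {a y : ℝ} (ha : 0 < a) (hy : 0 < y) :
    Real.Gamma y = Real.exp (levyExponent a y - levyExponent a 1
      - (levyExponent a 2 - levyExponent a 1) * (y - 1)) := by
  set D := levyExponent a 2 - levyExponent a 1 with hD
  have := Real.eq_Gamma_of_log_convex
    (f := fun y => Real.exp (levyExponent a y - levyExponent a 1 - D * (y - 1))) ?_ ?_
    (fun {y} _ => Real.exp_pos _) (by simp)
  · exact (this hy).symm
  · have e : (Real.log ∘ fun y => Real.exp (levyExponent a y - levyExponent a 1 - D * (y - 1)))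
        = fun y => levyExponent a y + (-D * y + (D - levyExponent a 1)) := by
      funext y
      simp only [Function.comp_apply, Real.log_exp]
      ring
    rw [e]
    refine (convexOn_levyExponent ha).add ⟨convex_Ioi 0, fun x _ y _ p q _ _ hpq => ?_⟩
    simp only [smul_eq_mul]
    linear_combination (levyExponent a 1 - D) * hpq
  · intro y hy
    have h := levyExponent_add_one_sub ha hy
    have e : ∀ r, y * Real.exp r = Real.exp (Real.log y + r) := fun r => by
      rw [Real.exp_add, Real.exp_log hy]
    rw [e]
    congr 1
    linarith

/-- Lévy–Khinchine representation of the Mellin transform of the `s`-th power of a `Gamma(a)`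
variable. -/
lemma exists_gamma_ratio_eq_exp {a s : ℝ} (ha : 0 < a) (hs : 0 < s) :
    ∃ c : ℝ, ∀ z, 0 ≤ z → Real.Gamma (a + s * z) / Real.Gamma a
      = Real.exp (c * z
        + ∫ u in Set.Ioi 0, (Real.exp (-(z * u)) - 1 + z * u) * gammaLevy a s u) := by
  refine ⟨-(levyExponent a 2 - levyExponent a 1) * s, fun z hz => ?_⟩
  have hz' : 0 < a + s * z := by positivity
  rw [gamma_eq_exp_levyExponent ha hz', gamma_eq_exp_levyExponent ha ha, ← Real.exp_sub]
  have h0 : levyExponent a a = 0 := by simp [levyExponent]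
  have h1 : levyExponent a (a + s * z)
      = ∫ u in Set.Ioi 0, (Real.exp (-(z * u)) - 1 + z * u) * gammaLevy a s u := by
    have h := integral_comp_mul_left_Ioi
      (fun u => (Real.exp (-(z * u)) - 1 + z * u) * gammaLevy a s u) 0 hs
    rw [mul_zero, smul_eq_mul, eq_comm, inv_mul_eq_iff_eq_mul₀ hs.ne', ← integral_const_mul] at h
    rw [h]
    refine setIntegral_congr_fun measurableSet_Ioi fun x hx => ?_
    have hx0 : 0 < x := hx
    have h1 := one_sub_exp_neg_pos hx0
    have e : s * x / s = x := by field_simp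
    have e' : -(a / s) * (s * x) = -(a / 1) * x := by field_simp
    have e'' : (a + s * z - a) * x = z * (s * x) := by ring
    simp only [gammaLevy, e, e', e'', div_one]
    field_simp
  rw [h0, h1]
  congr 1
  ring

/-- If the difference of the Lévy densities is nonnegative, a power of a Gamma moment function
divided by a power of another one is the moment function of a positive random variable, here given
through the law of its logarithm. -/
lemma exists_law_gamma_quotient {a s a' s' t w : ℝ} (ha : 0 < a) (hs : 0 < s) (ha' : 0 < a')
    (hs' : 0 < s') (ht : 0 ≤ t) (hw : 0 ≤ w)
    (h : ∀ u, 0 < u → w * gammaLevy a' s' u ≤ t * gammaLevy a s u) :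
    ∃ ρ : Measure ℝ, IsProbabilityMeasure ρ ∧ ∀ z, 0 ≤ z →
      Integrable (fun x => Real.exp (z * x)) ρ ∧ ∫ x, Real.exp (z * x) ∂ρ
        = (Real.Gamma (a + s * z) / Real.Gamma a) ^ t
          / (Real.Gamma (a' + s' * z) / Real.Gamma a') ^ w := by
  obtain ⟨c, hc⟩ := exists_gamma_ratio_eq_exp ha hs
  obtain ⟨c', hc'⟩ := exists_gamma_ratio_eq_exp ha' hs'
  have hint : ∀ {a s : ℝ}, 0 < a → 0 < s → ∀ z, 0 ≤ z → IntegrableOn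
      (fun u => (Real.exp (-(z * u)) - 1 + z * u) * gammaLevy a s u) (Set.Ioi 0) := by
    intro a s ha hs z hz
    have hd := div_pos ha hs
    obtain ⟨C, -, hC⟩ := exists_gammaLevy_bound (a := a) (δ := a / s / 2) hs (by linarith)
    refine integrableOn_compensated (C := C) (measurable_gammaLevy a s) (δ := a / s / 2)
      (by linarith) (fun x hx => ?_) (by linarith)
    rw [abs_of_nonneg (gammaLevy_nonneg hs hx)]
    exact hC x hx
  have hd := div_pos ha hs
  obtain ⟨C, -, hC⟩ := exists_gammaLevy_bound (a := a) (δ := 2 * (a / s / 4)) hs (by linarith)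
  obtain ⟨ρ, hρ, hρz⟩ := exists_law_of_levyDensity
    (κ := fun u => t * gammaLevy a s u - w * gammaLevy a' s' u) (C := t * C) (δ := a / s / 4)
    (t * c - w * c')
    (((measurable_gammaLevy a s).const_mul t).sub ((measurable_gammaLevy a' s').const_mul w))
    (by linarith) (fun u hu => sub_nonneg.2 (h u hu)) (fun u hu => by
      have h1 := mul_le_mul_of_nonneg_left (hC u hu) ht
      have h2 := mul_nonneg hw (gammaLevy_nonneg (a := a') hs' hu)
      rw [mul_assoc, mul_div_assoc]
      linarith)
  refine ⟨ρ, hρ, fun z hz => ⟨(hρz z hz).1, ?_⟩⟩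
  rw [(hρz z hz).2, hc z hz, hc' z hz, ← Real.exp_mul, ← Real.exp_mul, ← Real.exp_sub]
  congr 1
  have e : (fun u => (Real.exp (-(z * u)) - 1 + z * u)
      * (t * gammaLevy a s u - w * gammaLevy a' s' u))
      = fun u => t * ((Real.exp (-(z * u)) - 1 + z * u) * gammaLevy a s u)
        - w * ((Real.exp (-(z * u)) - 1 + z * u) * gammaLevy a' s' u) := by
    funext u; ring
  rw [e, integral_sub ((hint ha hs z hz).const_mul t) ((hint ha' hs' z hz).const_mul w),
    integral_const_mul, integral_const_mul]
  ring

/-! ### Uniqueness in the moment problem -/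

/-- Identity theorem on a vertical strip, from equality on its real section. -/
lemma eqOn_strip_of_eqOn_real {f g : ℂ → ℂ} {I : Set ℝ} (hI : Convex ℝ I) (ho : IsOpen I)
    {t : ℝ} (ht : t ∈ I) (hf : AnalyticOnNhd ℂ f {z | z.re ∈ I})
    (hg : AnalyticOnNhd ℂ g {z | z.re ∈ I}) (h : ∀ x ∈ I, f (x : ℂ) = g (x : ℂ)) :
    Set.EqOn f g {z | z.re ∈ I} := by
  refine hf.eqOn_of_preconnected_of_frequently_eq hg
    (hI.linear_preimage Complex.reLm).isPreconnected (z₀ := (t : ℂ)) (by simpa using ht) ?_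
  have h_real : ∃ᶠ (x : ℝ) in 𝓝[≠] t, f (x : ℂ) = g (x : ℂ) := by
    refine Eventually.frequently ?_
    filter_upwards [nhdsWithin_le_nhds (ho.mem_nhds ht)] with x hx using h x hx
  have hto : Tendsto (fun x : ℝ => (x : ℂ)) (𝓝[≠] t) (𝓝[≠] (t : ℂ)) := by
    refine tendsto_nhdsWithin_iff.2 ⟨?_, ?_⟩
    · exact (Complex.continuous_ofReal.tendsto t).mono_left nhdsWithin_le_nhds
    · filter_upwards [self_mem_nhdsWithin] with x hx
      simpa using hx
  exact hto.frequently h_real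

/-- A finite measure with finite exponential moments near `0` is determined by them. -/
lemma measure_ext_of_exp_moment {μ μ' : Measure ℝ} [IsFiniteMeasure μ] [IsFiniteMeasure μ'] {c : ℝ}
    (hc : 0 < c)
    (hi : ∀ z ∈ Set.Ioo (-c) c, Integrable (fun x => Real.exp (z * x)) μ)
    (hi' : ∀ z ∈ Set.Ioo (-c) c, Integrable (fun x => Real.exp (z * x)) μ')
    (h : ∀ z ∈ Set.Ioo (-c) c, ∫ x, Real.exp (z * x) ∂μ = ∫ x, Real.exp (z * x) ∂μ') :
    μ = μ' := by
  have hs : Set.Ioo (-c) c ⊆ interior (ProbabilityTheory.integrableExpSet id μ) :=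
    interior_maximal hi isOpen_Ioo
  have hs' : Set.Ioo (-c) c ⊆ interior (ProbabilityTheory.integrableExpSet id μ') :=
    interior_maximal hi' isOpen_Ioo
  have h0 : (0 : ℝ) ∈ Set.Ioo (-c) c := ⟨by linarith, hc⟩
  have key := eqOn_strip_of_eqOn_real (convex_Ioo (-c) c) isOpen_Ioo h0
    (ProbabilityTheory.analyticOnNhd_complexMGF.mono fun z hz => hs hz)
    (ProbabilityTheory.analyticOnNhd_complexMGF.mono fun z hz => hs' hz) (fun x hx => by
      rw [ProbabilityTheory.complexMGF_ofReal, ProbabilityTheory.complexMGF_ofReal]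
      exact congrArg _ (h x hx))
  refine Measure.ext_of_charFun ?_
  funext t
  rw [← ProbabilityTheory.complexMGF_id_mul_I, ← ProbabilityTheory.complexMGF_id_mul_I]
  exact key (by simpa using hc)

/-- The law on the whole line of `ε √X`, with `ε` a random sign, up to the factor `2`. -/
noncomputable def symmSqrt (ν : Measure ℝ) : Measure ℝ :=
  ν.map (fun x => √x) + ν.map (fun x => -√x)

instance isFiniteMeasure_symmSqrt (ν : Measure ℝ) [IsFiniteMeasure ν] :
    IsFiniteMeasure (symmSqrt ν) := by
  unfold symmSqrt; infer_instance

lemma IsMomentLaw.ae_nonneg {m : ℕ → ℝ} {ν : Measure ℝ} (h : IsMomentLaw m ν) :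
    ∀ᵐ x ∂ν, 0 ≤ x := by
  have := h.nonneg
  rw [ae_iff]
  convert this using 2
  ext x
  simp

/-- The even exponential moments of `√X` are power series in the moments of `X`. -/
lemma lintegral_exp_symmSqrt {m : ℕ → ℝ} {A D z : ℝ} (hD : 0 ≤ D)
    (hm : ∀ n, 1 ≤ n → m n ≤ A * D ^ n * (2 * n).factorial) (hz : z ^ 2 * D < 1) :
    ∃ E, 0 ≤ E ∧ ∀ ν, IsMomentLaw m ν →
      ∫⁻ x, ENNReal.ofReal (Real.exp (z * x)) ∂(symmSqrt ν) = ENNReal.ofReal E := by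
  by_cases hex : ∃ ν, IsMomentLaw m ν
  swap
  · exact ⟨0, le_rfl, fun ν hν => (hex ⟨ν, hν⟩).elim⟩
  -- the value `m 0` is unconstrained, while the power series of `cosh` has a constant term
  set M : ℕ → ℝ := fun n => if n = 0 then 1 else m n with hM
  have hmom : ∀ ν, IsMomentLaw m ν →
      ∀ n, Integrable (fun x : ℝ => x ^ n) ν ∧ ∫ x, x ^ n ∂ν = M n := by
    intro ν hν n
    have := hν.isProbabilityMeasure
    rcases Nat.eq_zero_or_pos n with rfl | hn
    · simp [hM]
    · exact ⟨hν.integrable n hn, by rw [hν.moment_eq n hn, hM]; simp [hn.ne']⟩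
  have hM0 : ∀ n, 0 ≤ M n := by
    obtain ⟨ν, hν⟩ := hex
    intro n
    rw [← (hmom ν hν n).2]
    exact integral_nonneg_of_ae (hν.ae_nonneg.mono fun x hx => pow_nonneg hx n)
  have hsum : Summable fun n : ℕ => 2 * (z ^ (2 * n) / (2 * n).factorial) * M n := by
    rw [← summable_nat_add_iff 1]
    have hgeo : Summable fun n : ℕ => 2 * A * (z ^ 2 * D) ^ (n + 1) :=
      ((summable_nat_add_iff 1).2
        (summable_geometric_of_lt_one (by positivity) hz)).mul_left (2 * A)
    refine Summable.of_nonneg_of_le (fun n => ?_) (fun n => ?_) hgeo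
    · have := hM0 (n + 1)
      have h2 : 0 ≤ z ^ (2 * (n + 1)) := by rw [pow_mul]; positivity
      positivity
    · have h1 := hm (n + 1) (by omega)
      have h2 : 0 ≤ z ^ (2 * (n + 1)) := by rw [pow_mul]; positivity
      have hf : (0 : ℝ) < ((2 * (n + 1)).factorial : ℝ) := by positivity
      have h3 : M (n + 1) = m (n + 1) := by simp [hM]
      calc 2 * (z ^ (2 * (n + 1)) / (2 * (n + 1)).factorial) * M (n + 1)
          ≤ 2 * (z ^ (2 * (n + 1)) / (2 * (n + 1)).factorial)
            * (A * D ^ (n + 1) * (2 * (n + 1)).factorial) := by rw [h3]; gcongr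
        _ = 2 * A * (z ^ 2 * D) ^ (n + 1) := by rw [mul_pow, ← pow_mul]; field_simp
  have hnn : ∀ n : ℕ, 0 ≤ 2 * (z ^ (2 * n) / (2 * n).factorial) * M n := fun n => by
    have := hM0 n
    have h2 : 0 ≤ z ^ (2 * n) := by rw [pow_mul]; positivity
    positivity
  refine ⟨∑' n : ℕ, 2 * (z ^ (2 * n) / (2 * n).factorial) * M n, tsum_nonneg hnn, fun ν hν => ?_⟩
  have hexpm : Measurable (fun x : ℝ => ENNReal.ofReal (Real.exp (z * x))) := by fun_prop
  rw [symmSqrt, lintegral_add_measure, lintegral_map hexpm (by fun_prop),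
    lintegral_map hexpm (by fun_prop), ← lintegral_add_left (by fun_prop),
    ENNReal.ofReal_tsum_of_nonneg hnn hsum]
  have hterm : ∀ n : ℕ, ENNReal.ofReal (2 * (z ^ (2 * n) / (2 * n).factorial) * M n)
      = ∫⁻ x, ENNReal.ofReal (2 * (z ^ (2 * n) / (2 * n).factorial) * x ^ n) ∂ν := by
    intro n
    have h2 : 0 ≤ z ^ (2 * n) := by rw [pow_mul]; positivity
    obtain ⟨i, e⟩ := hmom ν hν n
    rw [← e, ← integral_const_mul, ofReal_integral_eq_lintegral_ofReal (i.const_mul _)]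
    filter_upwards [hν.ae_nonneg] with x hx
    have := pow_nonneg hx n
    simp only [Pi.zero_apply]
    positivity
  simp only [hterm]
  rw [← lintegral_tsum fun n => by fun_prop]
  refine lintegral_congr_ae ?_
  filter_upwards [hν.ae_nonneg] with x hx
  have hcosh := (Real.hasSum_cosh (z * √x)).mul_left 2
  have e : ∀ n : ℕ, 2 * ((z * √x) ^ (2 * n) / ((2 * n).factorial : ℝ))
      = 2 * (z ^ (2 * n) / (2 * n).factorial) * x ^ n := fun n => by
    rw [mul_pow, pow_mul (√x), Real.sq_sqrt hx]; ring
  simp only [e] at hcosh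
  rw [← ENNReal.ofReal_tsum_of_nonneg (fun n => ?_) hcosh.summable, hcosh.tsum_eq,
    ← ENNReal.ofReal_add (Real.exp_pos _).le (Real.exp_pos _).le, Real.cosh_eq]
  · congr 1
    rw [mul_neg]
    ring
  · have h2 : 0 ≤ z ^ (2 * n) := by rw [pow_mul]; positivity
    have := pow_nonneg hx n
    positivity

/-- If `m n` is at most of the order `Dⁿ (2n)!`, then `√X` has exponential moments, so that the law
of a nonnegative `X` is determined by its moments. -/
lemma momentLaw_unique {m : ℕ → ℝ} {A D : ℝ} (hD : 0 < D)
    (hm : ∀ n, 1 ≤ n → m n ≤ A * D ^ n * (2 * n).factorial) {ν ν' : Measure ℝ}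
    (hν : IsMomentLaw m ν) (hν' : IsMomentLaw m ν') : ν = ν' := by
  have := hν.isProbabilityMeasure
  have := hν'.isProbabilityMeasure
  have hcz : ∀ z ∈ Set.Ioo (-√(1 / D)) √(1 / D), z ^ 2 * D < 1 := by
    intro z hz
    have h1 : |z| < √(1 / D) := abs_lt.2 hz
    have h2 : z ^ 2 < 1 / D := by
      rw [← sq_abs]
      exact (Real.lt_sqrt (abs_nonneg _)).1 h1
    exact (lt_div_iff₀ hD).1 h2
  have hsymm : symmSqrt ν = symmSqrt ν' := by
    refine measure_ext_of_exp_moment (c := √(1 / D)) (by positivity) (fun z hz => ?_)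
      (fun z hz => ?_) (fun z hz => ?_)
    all_goals
      obtain ⟨E, hE, h⟩ := lintegral_exp_symmSqrt hD.le hm (hcz z hz)
      have e := exp_moment_of_lintegral hE (h ν hν)
      have e' := exp_moment_of_lintegral hE (h ν' hν')
    · exact e.1
    · exact e'.1
    · exact e.2.trans e'.2.symm
  -- squaring undoes the symmetrization
  have hback : ∀ μ, IsMomentLaw m μ → (symmSqrt μ).map (fun x => x ^ 2) = μ + μ := by
    intro μ hμ
    rw [symmSqrt, Measure.map_add _ _ (by fun_prop), Measure.map_map (by fun_prop) (by fun_prop),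
      Measure.map_map (by fun_prop) (by fun_prop)]
    have e1 : (fun x : ℝ => x ^ 2) ∘ (fun x => √x) =ᵐ[μ] id := by
      filter_upwards [hμ.ae_nonneg] with x hx
      simp [Real.sq_sqrt hx]
    have e2 : (fun x : ℝ => x ^ 2) ∘ (fun x => -√x) =ᵐ[μ] id := by
      filter_upwards [hμ.ae_nonneg] with x hx
      simp [Real.sq_sqrt hx]
    rw [Measure.map_congr e1, Measure.map_congr e2, Measure.map_id]
  have h2 : ν + ν = ν' + ν' := by rw [← hback ν hν, ← hback ν' hν', hsymm]
  ext s hs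
  have h3 : ν s + ν s = ν' s + ν' s := by
    rw [← Measure.add_apply, h2, Measure.add_apply]
  rw [← two_mul, ← two_mul] at h3
  exact (ENNReal.mul_right_inj (by norm_num) (by norm_num)).1 h3

/-! ### Growth of the moments -/

/-- Exponentials of real random variables give positive random variables. -/
lemma isMomentSequence_of_exp_moment {m : ℕ → ℝ} {ρ : Measure ℝ} [IsProbabilityMeasure ρ]
    (h : ∀ n : ℕ, 1 ≤ n → Integrable (fun x => Real.exp (n * x)) ρ ∧
      ∫ x, Real.exp (n * x) ∂ρ = m n) : IsMomentSequence m := by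
  have hE : Measurable Real.exp := by fun_prop
  have hpow : ∀ (n : ℕ) (x : ℝ), Real.exp x ^ n = Real.exp (n * x) := fun n x =>
    (Real.exp_nat_mul x n).symm
  refine ⟨ρ.map Real.exp, ⟨Measure.isProbabilityMeasure_map hE.aemeasurable, ?_, fun n hn => ?_,
    fun n hn => ?_⟩, ?_⟩
  · rw [Measure.map_apply hE measurableSet_Iio]
    have : Real.exp ⁻¹' Set.Iio 0 = ∅ := by
      ext x; simpa using (Real.exp_pos x).le
    simp [this]
  · rw [integrable_map_measure (by fun_prop) hE.aemeasurable]
    simp only [Function.comp_def, hpow]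
    exact (h n hn).1
  · rw [integral_map hE.aemeasurable (by fun_prop)]
    simp only [hpow]
    exact (h n hn).2
  · rw [Measure.map_apply hE (measurableSet_singleton _)]
    have : Real.exp ⁻¹' {0} = ∅ := by
      ext x; simp
    simp [this]

/-- A crude Stirling bound, from `u ^ y ≤ (2 y) ^ y exp (u / 2)`. -/
lemma gamma_ratio_le {a y : ℝ} (ha : 0 < a) (hy : 0 < y) :
    Real.Gamma (a + y) / Real.Gamma a ≤ 2 ^ a * (2 * y) ^ y := by
  rw [div_le_iff₀ (Real.Gamma_pos_of_pos ha)]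
  have h1 := Real.integral_rpow_mul_exp_neg_mul_Ioi ha (show (0 : ℝ) < 1 / 2 by norm_num)
  rw [one_div_one_div] at h1
  have hi : IntegrableOn (fun u : ℝ => u ^ (a - 1) * Real.exp (-(1 / 2 * u))) (Set.Ioi 0) := by
    refine Integrable.of_integral_ne_zero ?_
    rw [h1]
    have := Real.Gamma_pos_of_pos ha
    positivity
  calc Real.Gamma (a + y) = ∫ u in Set.Ioi 0, Real.exp (-u) * u ^ (a + y - 1) :=
        Real.Gamma_eq_integral (by positivity)
    _ ≤ ∫ u in Set.Ioi 0, (2 * y) ^ y * (u ^ (a - 1) * Real.exp (-(1 / 2 * u))) := by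
        refine setIntegral_mono_on (Real.GammaIntegral_convergent (by positivity))
          (hi.const_mul _) measurableSet_Ioi fun u hu => ?_
        have hu : 0 < u := hu
        have h2 : (u / (2 * y)) ^ y ≤ Real.exp (u / 2) := by
          calc (u / (2 * y)) ^ y ≤ Real.exp (u / (2 * y)) ^ y := by
                gcongr
                linarith [Real.add_one_le_exp (u / (2 * y))]
            _ = Real.exp (u / 2) := by
                rw [← Real.exp_mul]
                congr 1
                field_simp
        rw [Real.div_rpow hu.le (by positivity), div_le_iff₀ (by positivity)] at h2
        have h3 : u ^ (a + y - 1) = u ^ (a - 1) * u ^ y := by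
          rw [← Real.rpow_add hu]; ring_nf
        have h4 : Real.exp (-u) * Real.exp (u / 2) = Real.exp (-(1 / 2 * u)) := by
          rw [← Real.exp_add]; ring_nf
        rw [h3]
        calc Real.exp (-u) * (u ^ (a - 1) * u ^ y)
            ≤ Real.exp (-u) * (u ^ (a - 1) * (Real.exp (u / 2) * (2 * y) ^ y)) := by gcongr
          _ = (2 * y) ^ y * (u ^ (a - 1) * (Real.exp (-u) * Real.exp (u / 2))) := by ring
          _ = _ := by rw [h4]
    _ = 2 ^ a * (2 * y) ^ y * Real.Gamma a := by
        rw [integral_const_mul, h1]; ring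

/-- For `s t ≤ 2`, the `t`-th powers of the Gamma moments do not exceed the order of `(2n)!`. -/
lemma exists_gamma_ratio_rpow_le {a s t : ℝ} (ha : 0 < a) (hs : 0 < s) (ht : 0 < t)
    (hst : s * t ≤ 2) :
    ∃ A D : ℝ, 0 < D ∧ ∀ n : ℕ, 1 ≤ n → (Real.Gamma (a + s * n) / Real.Gamma a) ^ t
      ≤ A * D ^ n * (2 * n).factorial := by
  set K := max (2 * s) 1 with hK
  have hK1 : 1 ≤ K := le_max_right _ _
  refine ⟨(2 ^ a) ^ t, (K * Real.exp 1) ^ 2, by positivity, fun n hn => ?_⟩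
  have hn' : (1 : ℝ) ≤ n := by exact_mod_cast hn
  have hn0 : (0 : ℝ) < n := by linarith
  have hg := gamma_ratio_le ha (show 0 < s * n by positivity)
  have hpos : 0 ≤ Real.Gamma (a + s * n) / Real.Gamma a :=
    div_nonneg (Real.Gamma_pos_of_pos (by positivity)).le (Real.Gamma_pos_of_pos ha).le
  have hfac : ((2 * n : ℕ) : ℝ) ^ (2 * n) ≤ Real.exp (2 * n : ℕ) * (2 * n).factorial := by
    have := Real.pow_div_factorial_le_exp ((2 * n : ℕ) : ℝ) (by positivity) (2 * n)
    rwa [div_le_iff₀ (by positivity)] at this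
  have hbase : 2 * (s * n) ≤ K * n := by
    have := le_max_left (2 * s) 1
    nlinarith
  calc (Real.Gamma (a + s * n) / Real.Gamma a) ^ t
      ≤ (2 ^ a * (2 * (s * n)) ^ (s * n)) ^ t := by gcongr
    _ = (2 ^ a) ^ t * (2 * (s * n)) ^ (s * n * t) := by
        rw [Real.mul_rpow (by positivity) (by positivity),
          ← Real.rpow_mul (by positivity : (0 : ℝ) ≤ 2 * (s * n))]
    _ ≤ (2 ^ a) ^ t * (K * n) ^ (s * n * t) := by gcongr
    _ ≤ (2 ^ a) ^ t * (K * n) ^ ((2 * n : ℕ) : ℝ) := by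
        gcongr
        · nlinarith
        · push_cast; nlinarith
    _ = (2 ^ a) ^ t * (K ^ (2 * n) * (n : ℝ) ^ (2 * n)) := by rw [Real.rpow_natCast, mul_pow]
    _ ≤ (2 ^ a) ^ t * (K ^ (2 * n) * (Real.exp (2 * n : ℕ) * (2 * n).factorial)) := by
        gcongr
        refine le_trans ?_ hfac
        gcongr
        linarith
    _ = (2 ^ a) ^ t * ((K * Real.exp 1) ^ 2) ^ n * (2 * n).factorial := by
        rw [← pow_mul, mul_pow, ← Real.exp_nat_mul, mul_one]; ring

/-- By convexity of `log Γ`. -/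
lemma gammaRatio_le_one {a b s x : ℝ} (ha : 0 < a) (hb : 0 < b) (hs : 0 < s) (hx : 0 ≤ x) :
    gammaRatio a b s x ≤ 1 := by
  have hy : 0 ≤ s * x := by positivity
  set y := s * x with hyd
  have g1 := Real.Gamma_pos_of_pos (show 0 < a + y by positivity)
  have g2 := Real.Gamma_pos_of_pos (show 0 < a + b by positivity)
  have g3 := Real.Gamma_pos_of_pos ha
  have g4 := Real.Gamma_pos_of_pos (show 0 < a + b + y by positivity)
  have hby : 0 < b + y := by positivity
  have hc := Real.convexOn_log_Gamma.2 (show a ∈ Set.Ioi (0 : ℝ) from ha)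
    (show a + b + y ∈ Set.Ioi (0 : ℝ) from by simp only [Set.mem_Ioi]; positivity)
  have c1 := hc (a := b / (b + y)) (b := y / (b + y)) (by positivity) (by positivity)
    (by field_simp)
  have c2 := hc (a := y / (b + y)) (b := b / (b + y)) (by positivity) (by positivity)
    (by field_simp; ring)
  have e1 : (b / (b + y)) * a + (y / (b + y)) * (a + b + y) = a + y := by field_simp; ring
  have e2 : (y / (b + y)) * a + (b / (b + y)) * (a + b + y) = a + b := by field_simp; ring
  simp only [smul_eq_mul, e1, e2, Function.comp_apply] at c1 c2
  have hsum : b / (b + y) + y / (b + y) = 1 := by field_simp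
  rw [gammaRatio, div_le_one (by positivity)]
  rw [← Real.log_le_log_iff (by positivity) (by positivity), Real.log_mul g1.ne' g2.ne',
    Real.log_mul g3.ne' g4.ne']
  linear_combination c1 + c2 + (Real.log (Real.Gamma a) + Real.log (Real.Gamma (a + b + y))) * hsum

/-! ### Indeterminacy -/

lemma integrableOn_gamma_density {A : ℝ} (hA : 0 < A) :
    IntegrableOn (fun u : ℝ => u ^ (A - 1) * Real.exp (-u)) (Set.Ioi 0) :=
  (Real.GammaIntegral_convergent hA).congr_fun (fun _ _ => mul_comm _ _) measurableSet_Ioi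

/-- Analytic continuation of `∫ u ^ (A - 1) exp (-(1 - t) u) = Γ(A) (1 - t) ^ (-A)` from real
`t < 1` to the imaginary axis. -/
lemma integral_gamma_density_mul_cexp {A : ℝ} (hA : 0 < A) (c : ℝ) :
    ∫ u in Set.Ioi (0 : ℝ), ((u ^ (A - 1) * Real.exp (-u) : ℝ) : ℂ)
        * Complex.exp (c * Complex.I * u)
      = Real.Gamma A * (1 - c * Complex.I) ^ (-A : ℂ) := by
  set d : ℝ → ℝ := fun u => u ^ (A - 1) * Real.exp (-u) with hd
  have hdm : Measurable d := by fun_prop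
  set G : Measure ℝ := (volume.restrict (Set.Ioi 0)).withDensity (fun u => ENNReal.ofReal (d u))
    with hG
  have hae : ∀ᵐ u ∂(volume.restrict (Set.Ioi (0 : ℝ))), 0 ≤ d u := by
    filter_upwards [ae_restrict_mem measurableSet_Ioi] with u hu
    have hu : 0 < u := hu
    positivity
  have hreal : ∀ t : ℝ, t < 1 → ∀ u : ℝ, d u * Real.exp (t * u)
      = u ^ (A - 1) * Real.exp (-((1 - t) * u)) := by
    intro t _ u
    rw [hd]
    simp only
    rw [mul_assoc, ← Real.exp_add]
    ring_nf
  have hval : ∀ t : ℝ, t < 1 → ∫ u, Real.exp (t * u) ∂G = (1 / (1 - t)) ^ A * Real.Gamma A := by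
    intro t ht
    rw [hG, integral_withDensity_eq_integral_toReal_smul (by fun_prop)
      (Eventually.of_forall fun x => ENNReal.ofReal_lt_top),
      ← Real.integral_rpow_mul_exp_neg_mul_Ioi hA (by linarith : 0 < 1 - t)]
    refine integral_congr_ae ?_
    filter_upwards [hae] with u hu
    rw [ENNReal.toReal_ofReal hu, smul_eq_mul, hreal t ht]
  have hint : ∀ t : ℝ, t < 1 → Integrable (fun u => Real.exp (t * u)) G := by
    intro t ht
    refine Integrable.of_integral_ne_zero ?_
    rw [hval t ht]
    have h1 : 0 < 1 - t := by linarith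
    have := Real.Gamma_pos_of_pos hA
    positivity
  have hs : Set.Iio (1 : ℝ) ⊆ interior (ProbabilityTheory.integrableExpSet id G) :=
    interior_maximal hint isOpen_Iio
  have hslit : ∀ z ∈ {z : ℂ | z.re ∈ Set.Iio (1 : ℝ)}, 1 - z ∈ Complex.slitPlane := by
    intro z hz
    left
    simp only [Complex.sub_re, Complex.one_re]
    have : z.re < 1 := hz
    linarith
  have key := eqOn_strip_of_eqOn_real (convex_Iio (1 : ℝ)) isOpen_Iio (t := 0)
    (by simp) (f := ProbabilityTheory.complexMGF id G)
    (g := fun z => Real.Gamma A * (1 - z) ^ (-A : ℂ))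
    (ProbabilityTheory.analyticOnNhd_complexMGF.mono fun z hz => hs hz)
    (fun z hz => analyticAt_const.mul
      ((analyticAt_const.sub analyticAt_id).cpow analyticAt_const (hslit z hz)))
    (fun t ht => by
      have ht : t < 1 := ht
      have h1 : 0 < 1 - t := by linarith
      rw [ProbabilityTheory.complexMGF_ofReal, ProbabilityTheory.mgf]
      simp only [id]
      rw [hval t ht, one_div, Real.inv_rpow h1.le, ← Real.rpow_neg h1.le]
      push_cast
      rw [Complex.ofReal_cpow h1.le]
      push_cast
      ring)
  have h := key (show (c * Complex.I : ℂ) ∈ {z : ℂ | z.re ∈ Set.Iio (1 : ℝ)} by simp)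
  rw [ProbabilityTheory.complexMGF, hG, integral_withDensity_eq_integral_toReal_smul (by fun_prop)
      (Eventually.of_forall fun x => ENNReal.ofReal_lt_top)] at h
  refine Eq.trans ?_ h
  refine integral_congr_ae ?_
  filter_upwards [hae] with u hu
  rw [ENNReal.toReal_ofReal hu, Complex.real_smul]
  rfl

/-- The Gamma integral along a ray, in real form. -/
lemma integral_gamma_density_mul_cos {A θ : ℝ} (hA : 0 < A) (h0 : 0 < θ) (h1 : θ < Real.pi / 2)
    (φ : ℝ) :
    ∫ u in Set.Ioi (0 : ℝ), u ^ (A - 1) * Real.exp (-u) * Real.cos (Real.tan θ * u - φ)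
      = Real.Gamma A * (Real.cos θ ^ A * Real.cos (A * θ - φ)) := by
  have hcos : 0 < Real.cos θ := Real.cos_pos_of_mem_Ioo ⟨by linarith, h1⟩
  have h := integral_gamma_density_mul_cexp hA (Real.tan θ)
  -- `1 - i tan θ = exp (-i θ) / cos θ`
  have hbase : (1 - (Real.tan θ : ℂ) * Complex.I)
      = Complex.exp ((-Real.log (Real.cos θ) : ℝ) + (-θ : ℝ) * Complex.I) := by
    rw [Complex.exp_add, ← Complex.ofReal_exp, Real.exp_neg, Real.exp_log hcos,
      Complex.exp_mul_I, ← Complex.ofReal_cos, ← Complex.ofReal_sin, Real.cos_neg, Real.sin_neg,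
      Real.tan_eq_sin_div_cos]
    push_cast
    have : (Complex.cos θ) ≠ 0 := by
      rw [← Complex.ofReal_cos]; exact_mod_cast hcos.ne'
    field_simp
    ring
  have hpow : (1 - (Real.tan θ : ℂ) * Complex.I) ^ (-A : ℂ)
      = ((Real.cos θ ^ A : ℝ) : ℂ) * Complex.exp ((A * θ : ℝ) * Complex.I) := by
    rw [hbase, Complex.cpow_def_of_ne_zero (Complex.exp_ne_zero _), Complex.log_exp,
      Real.rpow_def_of_pos hcos, Complex.ofReal_exp, ← Complex.exp_add]
    · congr 1
      push_cast
      ring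
    · simp; linarith [Real.pi_pos]
    · simp; linarith [Real.pi_pos]
  rw [hpow] at h
  have hI : IntegrableOn (fun u : ℝ => ((u ^ (A - 1) * Real.exp (-u) : ℝ) : ℂ)
      * Complex.exp ((Real.tan θ * u - φ : ℝ) * Complex.I)) (Set.Ioi 0) := by
    refine Integrable.mul_bdd (c := 1) (integrableOn_gamma_density hA).ofReal
      (by fun_prop) (Eventually.of_forall fun u => ?_)
    rw [Complex.norm_exp_ofReal_mul_I]
  have h2 : ∫ u in Set.Ioi (0 : ℝ), ((u ^ (A - 1) * Real.exp (-u) : ℝ) : ℂ)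
      * Complex.exp ((Real.tan θ * u - φ : ℝ) * Complex.I)
      = Real.Gamma A * (((Real.cos θ ^ A : ℝ) : ℂ)
        * Complex.exp ((A * θ - φ : ℝ) * Complex.I)) := by
    have e : ∀ r : ℝ, Complex.exp ((r - φ : ℝ) * Complex.I)
        = Complex.exp ((r : ℝ) * Complex.I) * Complex.exp ((-φ : ℝ) * Complex.I) := fun r => by
      rw [← Complex.exp_add]; congr 1; push_cast; ring
    simp only [e, ← mul_assoc]
    rw [integral_mul_const, mul_assoc (Real.Gamma A : ℂ), ← h]
    congr 1
    refine integral_congr_ae (Eventually.of_forall fun u => ?_)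
    simp only
    congr 2
    push_cast
    ring
  have h3 := congrArg Complex.re h2
  rw [← RCLike.re_eq_complex_re, ← integral_re hI] at h3
  simp only [RCLike.re_eq_complex_re, Complex.re_ofReal_mul, Complex.exp_ofReal_mul_I_re] at h3
  exact h3

/-- Laws of `|U| ^ s exp Y` for independent `U`, `Y`: the Mellin transforms multiply. The absolute
value only serves to make the rules for `rpow` hold everywhere. -/
lemma exists_law_mul_exp {P ρ : Measure ℝ} [IsProbabilityMeasure P] [IsProbabilityMeasure ρ] {s : ℝ}
    {Q R : ℝ → ℝ}
    (hP : ∀ p, 0 ≤ p → Integrable (fun u => |u| ^ (s * p)) P ∧ ∫ u, |u| ^ (s * p) ∂P = Q p)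
    (hρ : ∀ p, 0 ≤ p → Integrable (fun y => Real.exp (p * y)) ρ ∧ ∫ y, Real.exp (p * y) ∂ρ = R p) :
    ∃ ν : Measure ℝ, IsMomentLaw (fun n : ℕ => Q n * R n) ν ∧
      ∀ p : ℝ, 0 ≤ p → ∫ x, x ^ p ∂ν = Q p * R p := by
  set T : ℝ × ℝ → ℝ := fun q => |q.1| ^ s * Real.exp q.2 with hT
  have hTm : Measurable T := by fun_prop
  have hTp : ∀ (p : ℝ) (q : ℝ × ℝ), T q ^ p = |q.1| ^ (s * p) * Real.exp (p * q.2) := by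
    intro p q
    rw [hT]
    simp only
    rw [Real.mul_rpow (by positivity) (Real.exp_pos _).le, ← Real.rpow_mul (abs_nonneg _),
      ← Real.exp_mul, mul_comm q.2]
  have hint : ∀ p : ℝ, 0 ≤ p → Integrable (fun x : ℝ => x ^ p) ((P.prod ρ).map T) := by
    intro p hp
    rw [integrable_map_measure (by fun_prop) hTm.aemeasurable]
    simp only [Function.comp_def, hTp]
    exact (hP p hp).1.mul_prod (hρ p hp).1
  have hval : ∀ p : ℝ, 0 ≤ p → ∫ x, x ^ p ∂((P.prod ρ).map T) = Q p * R p := by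
    intro p hp
    rw [integral_map hTm.aemeasurable (by fun_prop)]
    simp only [hTp]
    rw [integral_prod_mul (fun u => |u| ^ (s * p)) (fun y => Real.exp (p * y)), (hP p hp).2,
      (hρ p hp).2]
  refine ⟨(P.prod ρ).map T, ⟨Measure.isProbabilityMeasure_map hTm.aemeasurable, ?_, fun n _ => ?_,
    fun n _ => ?_⟩, hval⟩
  · rw [Measure.map_apply hTm measurableSet_Iio]
    have : T ⁻¹' Set.Iio 0 = ∅ := by
      ext q
      simp only [Set.mem_preimage, Set.mem_Iio, Set.mem_empty_iff_false, iff_false, not_lt, hT]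
      positivity
    simp [this]
  · simpa using hint n n.cast_nonneg
  · simpa using hval n n.cast_nonneg

/-- The `Gamma(a)` density, perturbed by a factor `1 + j cos` with `j ∈ {0, 1}`. The perturbation
does not change the moments of order `s n` with integer `n`, since the cosine in the formula
vanishes at `p = n`. -/
lemma exists_perturbed_gamma {a s : ℝ} (ha : 0 < a) (hs : 2 < s) {j : ℝ} (hj0 : 0 ≤ j)
    (hj1 : j ≤ 1) :
    ∃ P : Measure ℝ, IsProbabilityMeasure P ∧ ∀ p, 0 ≤ p →
      Integrable (fun u => |u| ^ (s * p)) P ∧ ∫ u, |u| ^ (s * p) ∂P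
        = Real.Gamma (a + s * p) / Real.Gamma a
          * (1 + j * (Real.cos (Real.pi / s) ^ (a + s * p)
            * Real.cos (Real.pi * p - Real.pi / 2))) := by
  have hπ := Real.pi_pos
  have hΓ := Real.Gamma_pos_of_pos ha
  set θ := Real.pi / s with hθ
  have hθ0 : 0 < θ := by positivity
  have hθ1 : θ < Real.pi / 2 := by rw [hθ]; gcongr
  -- with this phase the cosine contributes a multiple of `cos (π p - π / 2)` to the moment `s p`
  set φ := a * θ + Real.pi / 2 with hφ
  set f : ℝ → ℝ := fun u => (Real.Gamma a)⁻¹ * (u ^ (a - 1) * Real.exp (-u)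
    * (1 + j * Real.cos (Real.tan θ * u - φ))) with hf
  have hfm : Measurable f := by fun_prop
  have hae : ∀ᵐ u ∂(volume.restrict (Set.Ioi (0 : ℝ))), 0 ≤ f u := by
    filter_upwards [ae_restrict_mem measurableSet_Ioi] with u hu
    have hu : 0 < u := hu
    have : 0 ≤ 1 + j * Real.cos (Real.tan θ * u - φ) := by
      nlinarith [Real.neg_one_le_cos (Real.tan θ * u - φ)]
    positivity
  set P : Measure ℝ := (volume.restrict (Set.Ioi 0)).withDensity (fun u => ENNReal.ofReal (f u))
    with hP
  have key : ∀ p, 0 ≤ p → IntegrableOn (fun u => |u| ^ (s * p) * f u) (Set.Ioi 0) ∧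
      ∫ u in Set.Ioi 0, |u| ^ (s * p) * f u = Real.Gamma (a + s * p) / Real.Gamma a
          * (1 + j * (Real.cos θ ^ (a + s * p) * Real.cos (Real.pi * p - Real.pi / 2))) := by
    intro p hp
    have hA : 0 < a + s * p := by positivity
    have hpt : ∀ u ∈ Set.Ioi (0 : ℝ), (Real.Gamma a)⁻¹ * (u ^ (a + s * p - 1) * Real.exp (-u)
        + j * (u ^ (a + s * p - 1) * Real.exp (-u) * Real.cos (Real.tan θ * u - φ)))
        = |u| ^ (s * p) * f u := by
      intro u hu
      have hu : 0 < u := hu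
      have e : u ^ (a + s * p - 1) = u ^ (s * p) * u ^ (a - 1) := by
        rw [← Real.rpow_add hu]; ring_nf
      rw [abs_of_pos hu, e, hf]
      ring
    have i1 := integrableOn_gamma_density hA
    have i2 : IntegrableOn (fun u : ℝ => u ^ (a + s * p - 1) * Real.exp (-u)
        * Real.cos (Real.tan θ * u - φ)) (Set.Ioi 0) := by
      refine Integrable.mul_bdd (c := 1) i1 (by fun_prop) (Eventually.of_forall fun u => ?_)
      exact Real.abs_cos_le_one _
    refine ⟨IntegrableOn.congr_fun ((i1.add (i2.const_mul j)).const_mul (Real.Gamma a)⁻¹) hpt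
      measurableSet_Ioi, ?_⟩
    rw [← setIntegral_congr_fun measurableSet_Ioi hpt, integral_const_mul,
      integral_add i1 (i2.const_mul j), integral_const_mul,
      integral_gamma_density_mul_cos hA hθ0 hθ1]
    have e1 : ∫ u in Set.Ioi (0 : ℝ), u ^ (a + s * p - 1) * Real.exp (-u)
        = Real.Gamma (a + s * p) := by
      rw [Real.Gamma_eq_integral hA]
      exact integral_congr_ae (Eventually.of_forall fun u => mul_comm _ _)
    have e2 : (a + s * p) * θ - φ = Real.pi * p - Real.pi / 2 := by
      rw [hφ, hθ]; field_simp; ring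
    rw [e1, e2]
    ring
  have hPI : ∀ p, 0 ≤ p → Integrable (fun u => |u| ^ (s * p)) P := by
    intro p hp
    rw [hP, integrable_withDensity_iff (by fun_prop)
      (Eventually.of_forall fun x => ENNReal.ofReal_lt_top)]
    refine (key p hp).1.congr ?_
    filter_upwards [hae] with x hx
    rw [ENNReal.toReal_ofReal hx]
  have hPv : ∀ p, 0 ≤ p → ∫ u, |u| ^ (s * p) ∂P = Real.Gamma (a + s * p) / Real.Gamma a
          * (1 + j * (Real.cos θ ^ (a + s * p) * Real.cos (Real.pi * p - Real.pi / 2))) := by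
    intro p hp
    rw [← (key p hp).2, hP, integral_withDensity_eq_integral_toReal_smul (by fun_prop)
      (Eventually.of_forall fun x => ENNReal.ofReal_lt_top)]
    refine integral_congr_ae ?_
    filter_upwards [hae] with x hx
    rw [ENNReal.toReal_ofReal hx, smul_eq_mul, mul_comm]
  have hi0 := hPI 0 le_rfl
  have h0 := hPv 0 le_rfl
  simp only [mul_zero, add_zero, zero_sub, Real.cos_neg, Real.cos_pi_div_two,
    Real.rpow_zero, div_self hΓ.ne', mul_one] at h0 hi0
  have hfin : IsFiniteMeasure P :=
    (integrable_const_iff_isFiniteMeasure (one_ne_zero : (1 : ℝ) ≠ 0)).1 hi0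
  refine ⟨P, ⟨?_⟩, fun p hp => ⟨hPI p hp, hPv p hp⟩⟩
  rw [integral_const, smul_eq_mul, mul_one, measureReal_def] at h0
  rw [← ENNReal.ofReal_toReal (measure_ne_top P Set.univ), h0, ENNReal.ofReal_one]

/-- A Gamma moment sequence with exponent `s > 2`, multiplied by the moments of an independent
positive factor, is indeterminate: the moment of order `1 / 2` separates two solutions. -/
lemma exists_ne_momentLaw {a s : ℝ} (ha : 0 < a) (hs : 2 < s) {ρ : Measure ℝ}
    [IsProbabilityMeasure ρ] {R : ℝ → ℝ}
    (hρ : ∀ p, 0 ≤ p → Integrable (fun y => Real.exp (p * y)) ρ ∧ ∫ y, Real.exp (p * y) ∂ρ = R p) :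
    ∃ ν ν', IsMomentLaw (fun n : ℕ => Real.Gamma (a + s * n) / Real.Gamma a * R n) ν ∧
      IsMomentLaw (fun n : ℕ => Real.Gamma (a + s * n) / Real.Gamma a * R n) ν' ∧ ν ≠ ν' := by
  have hπ := Real.pi_pos
  obtain ⟨P, hP, hPv⟩ := exists_perturbed_gamma ha hs (le_refl (0 : ℝ)) zero_le_one
  obtain ⟨P', hP', hPv'⟩ := exists_perturbed_gamma ha hs zero_le_one (le_refl (1 : ℝ))
  obtain ⟨ν, hν, hνv⟩ := exists_law_mul_exp hPv hρ
  obtain ⟨ν', hν', hνv'⟩ := exists_law_mul_exp hPv' hρ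
  have hcos : ∀ n : ℕ, Real.cos (Real.pi * n - Real.pi / 2) = 0 := fun n => by
    rw [Real.cos_sub_pi_div_two, mul_comm, Real.sin_nat_mul_pi]
  refine ⟨ν, ν', ?_, ?_, ?_⟩
  · convert hν using 3
    ring
  · convert hν' using 3
    rw [hcos]
    ring
  · intro h
    have h1 := hνv (1 / 2) (by norm_num)
    have h2 := hνv' (1 / 2) (by norm_num)
    rw [h, h2] at h1
    have hR : 0 < R (1 / 2) := by
      obtain ⟨i, e⟩ := hρ (1 / 2) (by norm_num)
      rw [← e]
      exact integral_exp_pos i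
    have g1 := Real.Gamma_pos_of_pos (show 0 < a + s * (1 / 2) by positivity)
    have g2 := Real.Gamma_pos_of_pos ha
    have hc : 0 < Real.cos (Real.pi / s) ^ (a + s * (1 / 2)) := by
      refine Real.rpow_pos_of_pos (Real.cos_pos_of_mem_Ioo ⟨?_, ?_⟩) _
      · have : 0 < Real.pi / s := by positivity
        linarith
      · gcongr
    have e : Real.pi * (1 / 2) - Real.pi / 2 = 0 := by ring
    rw [e, Real.cos_zero] at h1
    have h3 := mul_right_cancel₀ hR.ne' h1
    have h4 := mul_left_cancel₀ (div_pos g1 g2).ne' h3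
    linarith

/-- The Lévy density of the `t`-th power of the Gamma moment sequence dominates that of a Gamma
moment sequence with exponent `s t`: both are asymptotic to `s t u⁻²` at `0`. -/
lemma gammaLevy_mul_le {a s t u : ℝ} (hs : 0 < s) (ht : 0 < t) (hu : 0 < u) :
    gammaLevy (t * a + 1) (s * t) u ≤ t * gammaLevy a s u := by
  have hst : 0 < s * t := by positivity
  refine (gammaLevy_le hst hu).trans ?_
  refine le_trans ?_ (mul_le_mul_of_nonneg_left (le_gammaLevy hs hu) ht.le)
  have e : Real.exp (-((t * a + 1) / (s * t)) * u)
      = Real.exp (-(a / s) * u) * (Real.exp (u / (s * t)))⁻¹ := by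
    rw [← Real.exp_neg, ← Real.exp_add]
    congr 1
    field_simp
    ring
  have h1 : s * t + u ≤ s * t * Real.exp (u / (s * t)) := by
    have := Real.add_one_le_exp (u / (s * t))
    calc s * t + u = s * t * (u / (s * t) + 1) := by field_simp; ring
      _ ≤ _ := by gcongr
  rw [← mul_div_assoc]
  refine div_le_div_of_nonneg_right ?_ (by positivity)
  rw [e]
  have hp := Real.exp_pos (u / (s * t))
  calc (s * t + u) * (Real.exp (-(a / s) * u) * (Real.exp (u / (s * t)))⁻¹)
      ≤ (s * t * Real.exp (u / (s * t)))
        * (Real.exp (-(a / s) * u) * (Real.exp (u / (s * t)))⁻¹) := by gcongr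
    _ = t * (s * Real.exp (-(a / s) * u)) := by field_simp

/-! ### Sequences of Gamma ratios -/

lemma isMomentSequence_const_pow_mul {m : ℕ → ℝ} {c : ℝ} (hc : 0 < c) (h : IsMomentSequence m) :
    IsMomentSequence (fun n => c ^ n * m n) := by
  obtain ⟨ν, hν, h0⟩ := h
  have := hν.isProbabilityMeasure
  have hm : Measurable (fun x : ℝ => c * x) := by fun_prop
  refine ⟨ν.map (fun x => c * x), ⟨Measure.isProbabilityMeasure_map hm.aemeasurable, ?_,
    fun n hn => ?_, fun n hn => ?_⟩, ?_⟩
  · rw [Measure.map_apply hm measurableSet_Iio]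
    convert hν.nonneg using 2
    ext x
    simp [hc]
  · rw [integrable_map_measure (by fun_prop) hm.aemeasurable]
    simp only [Function.comp_def, mul_pow]
    exact (hν.integrable n hn).const_mul _
  · rw [integral_map hm.aemeasurable (by fun_prop)]
    simp only [mul_pow]
    rw [integral_const_mul, hν.moment_eq n hn]
  · rw [Measure.map_apply hm (measurableSet_singleton _)]
    convert h0 using 2
    ext x
    simp [hc.ne']

lemma gammaRatio_pos {a b s x : ℝ} (ha : 0 < a) (hb : 0 < b) (hs : 0 < s) (hx : 0 ≤ x) :
    0 < gammaRatio a b s x := by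
  have g1 := Real.Gamma_pos_of_pos (show 0 < a + s * x by positivity)
  have g2 := Real.Gamma_pos_of_pos (show 0 < a + b by positivity)
  have g3 := Real.Gamma_pos_of_pos ha
  have g4 := Real.Gamma_pos_of_pos (show 0 < a + b + s * x by positivity)
  unfold gammaRatio
  positivity

lemma isMomentSequence_gammaRatio_rpow {a b s t : ℝ} (ha : 0 < a) (hb : 0 < b) (hs : 0 < s)
    (ht : 0 < t) : IsMomentSequence (fun n : ℕ => gammaRatio a b s n ^ t) := by
  obtain ⟨ρ, hρ, h⟩ := exists_law_gamma_quotient (t := t) (w := t) ha hs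
    (show 0 < a + b by positivity) hs ht.le ht.le (fun u hu => by
      have := one_sub_exp_neg_pos (div_pos hu hs)
      unfold gammaLevy
      gcongr
      linarith)
  refine isMomentSequence_of_exp_moment (ρ := ρ) fun n _ => ⟨(h n n.cast_nonneg).1, ?_⟩
  rw [(h n n.cast_nonneg).2]
  have g1 := Real.Gamma_pos_of_pos (show 0 < a + s * n by positivity)
  have g2 := Real.Gamma_pos_of_pos (show 0 < a + b by positivity)
  have g3 := Real.Gamma_pos_of_pos ha
  have g4 := Real.Gamma_pos_of_pos (show 0 < a + b + s * n by positivity)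
  rw [← Real.div_rpow (by positivity) (by positivity), gammaRatio]
  congr 1
  field_simp

/-- Rescaled powers of the ratio grow at most geometrically, hence are determinate. -/
lemma isMomentDeterminate_gammaRatio {a b s t c : ℝ} (ha : 0 < a) (hb : 0 < b) (hs : 0 < s)
    (ht : 0 < t) (hc : 0 < c) :
    IsMomentDeterminate (fun n : ℕ => c ^ n * gammaRatio a b s n ^ t) := by
  refine ⟨isMomentSequence_const_pow_mul hc (isMomentSequence_gammaRatio_rpow ha hb hs ht),
    fun ν ν' hν hν' => momentLaw_unique (A := 1) hc (fun n _ => ?_) hν hν'⟩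
  have h1 : gammaRatio a b s n ^ t ≤ 1 :=
    Real.rpow_le_one (gammaRatio_pos ha hb hs n.cast_nonneg).le
      (gammaRatio_le_one ha hb hs n.cast_nonneg) ht.le
  have h2 : (1 : ℝ) ≤ (2 * n).factorial := by
    exact_mod_cast Nat.one_le_iff_ne_zero.2 (2 * n).factorial_ne_zero
  calc c ^ n * gammaRatio a b s n ^ t ≤ c ^ n * 1 := by gcongr
    _ ≤ c ^ n * (2 * n).factorial := by gcongr
    _ = 1 * c ^ n * (2 * n).factorial := by ring

lemma gammaRatio_mul_right (a b s t x : ℝ) :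
    gammaRatio a b s (x * t) = gammaRatio a b (s * t) x := by
  have e : s * (x * t) = s * t * x := by ring
  simp only [gammaRatio, e]

/-! ### Catalan numbers -/

lemma gammaRatio_half_eq_catalan (n : ℕ) :
    gammaRatio (1 / 2) (3 / 2) 1 (n : ℝ) = (catalan n : ℝ) / 4 ^ n := by
  have e : ∀ x : ℝ, gammaRatio (1 / 2) (3 / 2) 1 x
      = Real.Gamma (1 / 2 + x) / (Real.Gamma (1 / 2) * Real.Gamma (2 + x)) := by
    intro x
    have h2 : Real.Gamma (1 / 2 + 3 / 2) = 1 := by norm_num [Real.Gamma_two]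
    rw [gammaRatio, h2]
    norm_num
  rw [e]
  have hpos := Real.Gamma_pos_of_pos (show (0 : ℝ) < 1 / 2 by norm_num)
  induction n with
  | zero =>
    simpa using hpos.ne'
  | succ n ih =>
    have hn : (0 : ℝ) ≤ n := n.cast_nonneg
    have g2 := Real.Gamma_pos_of_pos (show (0 : ℝ) < 2 + n by positivity)
    have e1 : Real.Gamma (1 / 2 + ((n + 1 : ℕ) : ℝ)) = (1 / 2 + n) * Real.Gamma (1 / 2 + n) := by
      rw [← Real.Gamma_add_one (by positivity)]; push_cast; ring_nf
    have e2 : Real.Gamma (2 + ((n + 1 : ℕ) : ℝ)) = (2 + n) * Real.Gamma (2 + n) := by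
      rw [← Real.Gamma_add_one (by positivity)]; push_cast; ring_nf
    have hrec : ((n : ℝ) + 2) * catalan (n + 1) = 2 * (2 * n + 1) * catalan n := by
      have h1 := succ_mul_catalan_eq_centralBinom n
      have h2 := succ_mul_catalan_eq_centralBinom (n + 1)
      have h3 := Nat.succ_mul_centralBinom_succ n
      have h4 : (n + 1) * ((n + 2) * catalan (n + 1))
          = (n + 1) * (2 * (2 * n + 1) * catalan n) := by
        rw [show n + 2 = n + 1 + 1 from rfl, h2, h3, ← h1]; ring
      have h5 := Nat.eq_of_mul_eq_mul_left n.succ_pos h4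
      exact_mod_cast h5
    rw [e1, e2, pow_succ]
    have h3 : (catalan (n + 1) : ℝ) = 2 * (2 * n + 1) / (n + 2) * catalan n := by
      rw [div_mul_eq_mul_div, eq_div_iff (by positivity)]
      linarith
    calc (1 / 2 + (n : ℝ)) * Real.Gamma (1 / 2 + n)
          / (Real.Gamma (1 / 2) * ((2 + n) * Real.Gamma (2 + n)))
        = (1 / 2 + n) / (2 + n)
          * (Real.Gamma (1 / 2 + n) / (Real.Gamma (1 / 2) * Real.Gamma (2 + n))) := by
          field_simp
      _ = (catalan (n + 1) : ℝ) / (4 ^ n * 4) := by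
          rw [ih, h3]; field_simp; ring

lemma isMomentDeterminate_catalan_rpow {t : ℝ} (ht : 0 < t) :
    IsMomentDeterminate (fun n : ℕ => (catalan n : ℝ) ^ t) := by
  have h := isMomentDeterminate_gammaRatio (a := 1 / 2) (b := 3 / 2) (s := 1) (t := t)
    (c := 4 ^ t) (by norm_num) (by norm_num) one_pos ht (by positivity)
  convert h using 2 with n
  rw [gammaRatio_half_eq_catalan, Real.div_rpow (by positivity) (by positivity),
    ← Real.rpow_natCast (4 ^ t) n, ← Real.rpow_natCast 4 n, ← Real.rpow_mul (by norm_num),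
    ← Real.rpow_mul (by norm_num), mul_comm t]
  field_simp

/-! ### The limit of large `b` -/

/-- The difference quotients of `log Γ` over `[x, x + y]` lie between those over `[x - 1, x]` and
`[x + y, x + y + 1]`, which are `log (x - 1)` and `log (x + y)`. -/
lemma gamma_add_div_bounds {x y : ℝ} (hx : 1 < x) (hy : 0 ≤ y) :
    (x - 1) ^ y ≤ Real.Gamma (x + y) / Real.Gamma x ∧
      Real.Gamma (x + y) / Real.Gamma x ≤ (x + y) ^ y := by
  have hx0 : 0 < x - 1 := by linarith
  have hx1 : 0 < x := by linarith
  have hxy : 0 < x + y := by linarith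
  rcases hy.eq_or_lt with rfl | hy
  · have := (Real.Gamma_pos_of_pos hx1).ne'
    simp [this]
  have g1 := Real.Gamma_pos_of_pos hx1
  have g2 := Real.Gamma_pos_of_pos hxy
  have s1 := Real.convexOn_log_Gamma.slope_mono_adjacent (x := x - 1) (y := x) (z := x + y)
    hx0 hxy (by linarith) (by linarith)
  have s2 := Real.convexOn_log_Gamma.slope_mono_adjacent (x := x) (y := x + y) (z := x + y + 1)
    hx1 (show 0 < x + y + 1 by linarith) (by linarith) (by linarith)
  have r1 : Real.log (Real.Gamma x) = Real.log (x - 1) + Real.log (Real.Gamma (x - 1)) := by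
    rw [← Real.log_mul hx0.ne' (Real.Gamma_pos_of_pos hx0).ne', ← Real.Gamma_add_one hx0.ne',
      sub_add_cancel]
  have r2 : Real.log (Real.Gamma (x + y + 1))
      = Real.log (x + y) + Real.log (Real.Gamma (x + y)) := by
    rw [← Real.log_mul hxy.ne' g2.ne', ← Real.Gamma_add_one hxy.ne']
  simp only [Function.comp_apply, sub_sub_cancel, add_sub_cancel_left, div_one] at s1 s2
  rw [le_div_iff₀ hy] at s1
  rw [div_le_iff₀ hy] at s2
  rw [Real.rpow_def_of_pos hx0, Real.rpow_def_of_pos hxy, ← Real.exp_log (div_pos g2 g1),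
    Real.log_div g2.ne' g1.ne', Real.exp_le_exp, Real.exp_le_exp]
  constructor <;> nlinarith

/-- By squeezing between `(b / (a + b + y)) ^ y` and `(b / (a + b - 1)) ^ y`. -/
lemma tendsto_rpow_mul_gamma_div {a y : ℝ} (ha : 0 < a) (hy : 0 ≤ y) :
    Tendsto (fun b : ℝ => b ^ y * (Real.Gamma (a + b) / Real.Gamma (a + b + y))) atTop (𝓝 1) := by
  have hlim : ∀ c : ℝ, Tendsto (fun b : ℝ => (b / (b + c)) ^ y) atTop (𝓝 1) := by
    intro c
    have h1 : Tendsto (fun b : ℝ => b / (b + c)) atTop (𝓝 1) := by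
      have h2 : Tendsto (fun b : ℝ => 1 - c / (b + c)) atTop (𝓝 (1 - 0)) :=
        tendsto_const_nhds.sub
          (tendsto_const_nhds.div_atTop (tendsto_atTop_add_const_right _ _ tendsto_id))
      rw [sub_zero] at h2
      refine h2.congr' ?_
      filter_upwards [eventually_gt_atTop (-c)] with b hb
      have : b + c ≠ 0 := by linarith
      field_simp
      ring
    simpa using h1.rpow_const (p := y) (Or.inr hy)
  refine tendsto_of_tendsto_of_tendsto_of_le_of_le' (hlim (a + y)) (hlim (a - 1)) ?_ ?_
  all_goals
    filter_upwards [eventually_gt_atTop 1] with b hb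
    have hb0 : 0 < b := by linarith
    have hx1 : 0 < b + (a - 1) := by linarith
    obtain ⟨h1, h2⟩ := gamma_add_div_bounds (show 1 < a + b by linarith) hy
    have g1 := Real.Gamma_pos_of_pos (show 0 < a + b by linarith)
    have g2 := Real.Gamma_pos_of_pos (show 0 < a + b + y by linarith)
    rw [← inv_div (Real.Gamma (a + b + y)), ← div_eq_mul_inv,
      Real.div_rpow hb0.le (by linarith)]
  · rw [show b + (a + y) = a + b + y by ring]
    gcongr
  · rw [show b + (a - 1) = a + b - 1 by ring]
    have : 0 < a + b - 1 := by linarith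
    gcongr

/-! ### Powers of Gamma moments -/

lemma isMomentSequence_gamma_rpow {a s t : ℝ} (ha : 0 < a) (hs : 0 < s) (ht : 0 < t) :
    IsMomentSequence (fun n : ℕ => (Real.Gamma (a + s * n) / Real.Gamma a) ^ t) := by
  obtain ⟨ρ, hρ, h⟩ := exists_law_gamma_quotient (t := t) (w := 0) ha hs ha hs ht.le le_rfl
    (fun u hu => by
      have := gammaLevy_nonneg (a := a) hs hu
      rw [zero_mul]
      positivity)
  refine isMomentSequence_of_exp_moment (ρ := ρ) fun n _ => ⟨(h n n.cast_nonneg).1, ?_⟩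
  rw [(h n n.cast_nonneg).2, Real.rpow_zero, div_one]

/-- For `s t > 2` the sequence is the product of the moment sequence of `U ^ (s t)`, where `U` has a
Gamma law, and of a further moment sequence. -/
lemma exists_ne_momentLaw_gamma_rpow {a s t : ℝ} (ha : 0 < a) (hs : 0 < s) (ht : 0 < t)
    (hst : 2 < s * t) : ∃ ν ν',
      IsMomentLaw (fun n : ℕ => (Real.Gamma (a + s * n) / Real.Gamma a) ^ t) ν ∧
      IsMomentLaw (fun n : ℕ => (Real.Gamma (a + s * n) / Real.Gamma a) ^ t) ν' ∧ ν ≠ ν' := by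
  have ha' : 0 < t * a + 1 := by positivity
  obtain ⟨ρ, hρ, h⟩ := exists_law_gamma_quotient (t := t) (w := 1) ha hs ha'
    (show 0 < s * t by positivity) ht.le zero_le_one
    (fun u hu => by rw [one_mul]; exact gammaLevy_mul_le hs ht hu)
  obtain ⟨ν, ν', h1, h2, h3⟩ := exists_ne_momentLaw ha' hst h
  have e : (fun n : ℕ => Real.Gamma (t * a + 1 + s * t * n) / Real.Gamma (t * a + 1)
      * ((Real.Gamma (a + s * n) / Real.Gamma a) ^ t
        / (Real.Gamma (t * a + 1 + s * t * n) / Real.Gamma (t * a + 1)) ^ (1 : ℝ)))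
      = fun n : ℕ => (Real.Gamma (a + s * n) / Real.Gamma a) ^ t := by
    funext n
    have g1 := Real.Gamma_pos_of_pos (show 0 < t * a + 1 + s * t * n by positivity)
    have g2 := Real.Gamma_pos_of_pos ha'
    rw [Real.rpow_one, mul_div_cancel₀ _ (div_pos g1 g2).ne']
  rw [e] at h1 h2
  exact ⟨ν, ν', h1, h2, h3⟩

end StieltjesMoment

open StieltjesMoment

theorem mainTheorem8 :
    (∀ a b s : ℝ, 0 < a → 0 < b → 0 < s →
      StieltjesMoment.IsInfinitelyDivisible
          (fun n : ℕ => StieltjesMoment.gammaRatio a b s (n : ℝ)) ∧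
        ∀ t : ℝ, 0 < t →
          StieltjesMoment.IsMomentDeterminate
              (fun n : ℕ => StieltjesMoment.gammaRatio a b s (n : ℝ) ^ t) ∧
            StieltjesMoment.IsMomentDeterminate
              (fun n : ℕ => StieltjesMoment.gammaRatio a b s ((n : ℝ) * t))) ∧
    ((∀ n : ℕ, StieltjesMoment.gammaRatio (1 / 2) (3 / 2) 1 (n : ℝ)
          = (catalan n : ℝ) / 4 ^ n) ∧
      StieltjesMoment.IsInfinitelyDivisible (fun n : ℕ => (catalan n : ℝ)) ∧
      (∀ t : ℝ, 0 < t →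
        StieltjesMoment.IsMomentDeterminate (fun n : ℕ => (catalan n : ℝ) ^ t)) ∧
      ∀ k : ℕ, 1 ≤ k →
        StieltjesMoment.IsMomentDeterminate (fun n : ℕ => (catalan (k * n) : ℝ))) ∧
    (∀ a s : ℝ, 0 < a → 0 < s →
      (∀ n : ℕ, Tendsto
          (fun b : ℝ => b ^ (s * (n : ℝ)) * StieltjesMoment.gammaRatio a b s (n : ℝ))
          atTop (𝓝 (Real.Gamma (a + s * (n : ℝ)) / Real.Gamma a))) ∧
        StieltjesMoment.IsInfinitelyDivisible
          (fun n : ℕ => Real.Gamma (a + s * (n : ℝ)) / Real.Gamma a) ∧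
        ∀ t : ℝ, 0 < t →
          (StieltjesMoment.IsMomentDeterminate
              (fun n : ℕ => (Real.Gamma (a + s * (n : ℝ)) / Real.Gamma a) ^ t) ↔
            s * t ≤ 2)) := by
  refine ⟨fun a b s ha hb hs => ⟨fun t ht => isMomentSequence_gammaRatio_rpow ha hb hs ht,
    fun t ht => ⟨?_, ?_⟩⟩, ⟨gammaRatio_half_eq_catalan, ?_, ?_, fun k hk => ?_⟩,
    fun a s ha hs => ⟨fun n => ?_, fun t ht => isMomentSequence_gamma_rpow ha hs ht,
      fun t ht => ⟨fun h => ?_, fun hst => ⟨isMomentSequence_gamma_rpow ha hs ht, ?_⟩⟩⟩⟩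
  · simpa using isMomentDeterminate_gammaRatio ha hb hs ht one_pos
  -- the values at `n t` form the sequence with `s` replaced by `s t`
  · simpa [gammaRatio_mul_right] using
      isMomentDeterminate_gammaRatio ha hb (mul_pos hs ht) one_pos one_pos
  · exact fun t ht => (isMomentDeterminate_catalan_rpow ht).1
  · exact fun t ht => isMomentDeterminate_catalan_rpow ht
  · have hk' : (0 : ℝ) < k := by exact_mod_cast hk
    have h := isMomentDeterminate_gammaRatio (a := 1 / 2) (b := 3 / 2) (s := 1 * k) (t := 1)
      (c := 4 ^ k) (by norm_num) (by norm_num) (by positivity) one_pos (by positivity)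
    convert h using 2 with n
    rw [Real.rpow_one, ← gammaRatio_mul_right, ← Nat.cast_mul, gammaRatio_half_eq_catalan,
      mul_comm n k, pow_mul]
    field_simp
  · have h := (tendsto_rpow_mul_gamma_div ha (show 0 ≤ s * n by positivity)).const_mul
      (Real.Gamma (a + s * n) / Real.Gamma a)
    rw [mul_one] at h
    refine h.congr fun b => ?_
    rw [gammaRatio]
    ring
  · by_contra! hst
    obtain ⟨ν, ν', h1, h2, hne⟩ := exists_ne_momentLaw_gamma_rpow ha hs ht hst
    exact hne (h.2 ν ν' h1 h2)
  · obtain ⟨A, D, hD, hb⟩ := exists_gamma_ratio_rpow_le ha hs ht hst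
    exact fun ν ν' h1 h2 => momentLaw_unique hD hb h1 h2
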